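/- **Setting.** Let $\mathcal M=(S,A,T,AP,L)$ be a finite Markov decision process: $S,A,AP$ are finite, $A(s)\neq\emptyset$ is the set of actions available in $s$, $T(s,a)$ is a probability distribution on $S$ for $a\in A(s)$, and $L:S\to 2^{AP}$ is a labelling. Strategies may depend on the history and randomize; a strategy is positional if it is pure and stationary. $\mathcal M$ is *communicating* if for all $s,s'\in S$ some strategy reaches $s'$ from $s$ with positive probability. Let $\mathcal A=(2^{AP},Q,q_0,\delta,F)$ be a finite nondeterministic Büchi automaton with accepting transitions $F\subseteq Q\times 2^{AP}\times Q$; its language $\mathcal L(\mathcal A)$ consists of the infinite words that have a run from $q_0$ in which some transition of $F$ occurs infinitely often. For a strategy $\sigma$ of $\mathcal M$ let $\mathrm{PSemSat}^{\mathcal M}_{\mathcal A}(s,\sigma)$ be the probability that the label word $L(s_0)L(s_1)\cdots$ of a run from $s$ under $\sigma$ lies in $\mathcal L(\mathcal A)$, and let $\mathrm{PSemSat}^{\mathcal M}_{\mathcal A}(s)=\sup_\sigma \mathrm{PSemSat}^{\mathcal M}_{\mathcal A}(s,\sigma)$. In the product $\mathcal M\times\mathcal A$, with states $S\times Q$, the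 action $(a,q')$ is available in $(s,q)$ if $a\in A(s)$ and $q'\in\delta(q,L(s))$, and leads to $(s',q')$ with probability $T(s,a)(s')$; it is accepting if $(q,L(s),q')\in F$; a run that arrives at a state without available action halts and is not accepting. $\mathcal A$ is *good for MDPs* if for every finite MDP $\mathcal N$ labelled over $AP$ and every state $s$ of $\mathcal N$, the supremum, over the strategies of $\mathcal N\times\mathcal A$, of the probability that a run from $(s,q_0)$ makes infinitely many accepting steps equals $\mathrm{PSemSat}^{\mathcal N}_{\mathcal A}(s)$. A language $\mathcal L\subseteq\Sigma^\omega$ is an *absolute liveness* language if it is non-empty and $uw\in\mathcal L$ for all $u\in\Sigma^*$ and $w\in\mathcal L$. For $c\in\mathbb R$ the reward machine $\mathcal R_{\mathcal A}$ has the states and transitions of $\mathcal A$ and, from every state, an $\varepsilon$-transition (reset) to $q_0$. Its reward is $c$ on $\varepsilon$-transitions, $1$ on transitions in $F$, and $0$ on the other transitions. The product $\mathcal M\times\mathcal R_{\mathcal A}$ has the states $S\times Q$, the actions $(a,q')$ of $\mathcal M\times\mathcal A$ with the rewards of the corresponding transitions of $\mathcal R_{\mathcal A}$, and in every state the action $\varepsilon$,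 which leads from $(s,q)$ to $(s,q_0)$ with reward $c$. The average reward of a strategy $\sigma$ from a state $x$ is $\limsup_{N\to\infty}\frac1N\,\mathbb E_{\sigma,x}\bigl[\sum_{i=1}^N\rho_i\bigr]$, where $\rho_i$ is the reward of the $i$-th step. **Lemma (Average and Probability).** Let $\mathcal M$ be a finite communicating MDP and let $\mathcal A$ be a Büchi automaton that is good for MDPs and whose language is an absolute liveness language. There is $c^*<0$ (depending only on $\mathcal M$ and $\mathcal A$) such that for all $c<c^*$, every positional strategy $\pi$ of $\mathcal M\times\mathcal R_{\mathcal A}$ and every $s\in S$: if $\pi$ maximizes the average reward from $(s,q_0)$ among all strategies of $\mathcal M\times\mathcal R_{\mathcal A}$, then $\pi$ maximizes the probability of satisfying $\mathcal A$ from $s$, that is: 1. the probability that a run of $\mathcal M\times\mathcal R_{\mathcal A}$ from $(s,q_0)$ under $\pi$ contains infinitely many non-$\varepsilon$ steps, and that the word of the labels of the states of $\mathcal M$ at these steps lies in $\mathcal L(\mathcal A)$, is equal to $\mathrm{PSemSat}^{\mathcal M}_{\mathcal A}(s)$; and 2. the finite-memory strategy $\hat\pi$ of $\mathcal M$ that $\pi$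 induces satisfies $\mathrm{PSemSat}^{\mathcal M}_{\mathcal A}(s,\hat\pi)=\mathrm{PSemSat}^{\mathcal M}_{\mathcal A}(s)$. Here $\hat\pi$ has memory $Q$ and initial memory state $q_0$; in state $s$ with memory $q$, if $\pi(s,q)=(a,q')$, or if $\pi(s,q)=\varepsilon$ and $\pi(s,q_0)=(a,q')$, it plays $a$ and the memory becomes $q'$; if $\pi(s,q)=\pi(s,q_0)=\varepsilon$, it plays an arbitrary fixed action available in $s$ and the memory becomes $q_0$. -/

import Mathlib

open MeasureTheory ProbabilityTheory Filter
open scoped ENNReal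

universe u v w x

/-! ### Markov decision processes, strategies and the law of runs -/

/-- A Markov decision process on the states `S` and the actions `Act`. The set `avail s` of actions
that can be selected in `s` is non-empty; the values `T s a` for `a ∉ avail s` are irrelevant, so
that `T` is a partial function of `(s, a)`. The initial state is a parameter of the notions below. -/
structure MDP (S : Type u) (Act : Type v) where
  avail : S → Set Act
  avail_nonempty : ∀ s, (avail s).Nonempty
  T : S → Act → PMF S

/-- An MDP with a labelling of its states by sets of atomic propositions. -/
structure LabelledMDP (S : Type u) (Act : Type v) (AP : Type w) extends MDP S Act where
  label : S → Set AP

/-- One step of a run: the current state and the action selected there. A run `s₀, a₁, s₁, a₂, …`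
is the sequence of steps `(s₀, a₁), (s₁, a₂), …`. -/
structure Step (S : Type u) (Act : Type v) where
  state : S
  action : Act

instance {S : Type u} {Act : Type v} : MeasurableSpace (Step S Act) := ⊤

instance {S : Type u} {Act : Type v} : DiscreteMeasurableSpace (Step S Act) :=
  ⟨fun _ => MeasurableSpace.measurableSet_top⟩

instance {S : Type u} {Act : Type v} [Finite S] [Finite Act] : Finite (Step S Act) :=
  Finite.of_injective (fun z : Step S Act => (z.state, z.action)) (by
    rintro ⟨s, a⟩ ⟨s', a'⟩ h
    simpa using h)

namespace MDP

variable {S : Type u} {Act : Type v}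

/-- A (history-dependent, randomized) strategy: after the finite run `s₀, a₁, …, aₙ, sₙ`, given by
the list `[(s₀, a₁), …, (sₙ₋₁, aₙ)]` and the last state `sₙ`, it selects a distribution on the
actions that are available in `sₙ`. -/
structure Strategy (M : MDP S Act) where
  choose : List (Step S Act) → S → PMF Act
  support_subset : ∀ h s, (choose h s).support ⊆ M.avail s

/-- A positional (pure and stationary) strategy. -/
structure Positional (M : MDP S Act) where
  choose : S → Act
  mem_avail : ∀ s, choose s ∈ M.avail s

/-- A positional strategy as a strategy. -/
noncomputable def Positional.toStrategy {M : MDP S Act} (π : M.Positional) : M.Strategy where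
  choose _ s := PMF.pure (π.choose s)
  support_subset := by
    intro _ s a ha
    rw [PMF.support_pure, Set.mem_singleton_iff] at ha
    exact ha ▸ π.mem_avail s

/-- The distribution of the next step (next state, and action selected there), given the past. -/
noncomputable def nextStep (M : MDP S Act) (σ : M.Strategy) (n : ℕ)
    (z : (i : Finset.Iic n) → Step S Act) : PMF (Step S Act) :=
  (M.T (z ⟨n, by simp⟩).state (z ⟨n, by simp⟩).action).bind fun s' =>
    (σ.choose (List.ofFn fun i : Fin (n + 1) => z ⟨i, by simp; omega⟩) s').map (Step.mk s')

variable [Finite S] [Finite Act]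

/-- `nextStep` as a Markov kernel. -/
noncomputable def stepKernel (M : MDP S Act) (σ : M.Strategy) (n : ℕ) :
    Kernel ((i : Finset.Iic n) → Step S Act) (Step S Act) :=
  Kernel.ofFunOfCountable fun z => (M.nextStep σ n z).toMeasure

instance (M : MDP S Act) (σ : M.Strategy) (n : ℕ) : IsMarkovKernel (M.stepKernel σ n) :=
  ⟨fun z => inferInstanceAs (IsProbabilityMeasure (M.nextStep σ n z).toMeasure)⟩

/-- The law of the runs that start in `s` and follow `σ`. -/
noncomputable def runMeasure (M : MDP S Act) (σ : M.Strategy) (s : S) :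
    Measure (ℕ → Step S Act) :=
  Kernel.trajMeasure (X := fun _ => Step S Act)
    ((σ.choose [] s).map (Step.mk s)).toMeasure (M.stepKernel σ)

/-- Every state can be reached from every state, with positive probability, by some strategy. -/
def IsCommunicating (M : MDP S Act) : Prop :=
  ∀ s s' : S, ∃ σ : M.Strategy, 0 < M.runMeasure σ s {z | ∃ n, (z n).state = s'}

/-- The average reward `limsup_N (1/N) 𝔼 ∑_{i=1}^N ρ(X_{i-1}, Y_i, X_i)` from the state `s`. -/
noncomputable def avgReward (M : MDP S Act) (ρ : S → Act → S → ℝ) (σ : M.Strategy) (s : S) : ℝ :=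
  limsup (fun N : ℕ => (1 / (N : ℝ)) *
    ∫ z, ∑ i ∈ Finset.range N, ρ (z i).state (z i).action (z (i + 1)).state ∂(M.runMeasure σ s))
    atTop

/-- `σ` maximizes the average reward from `s` among all strategies. -/
def IsAvgOptimalFrom (M : MDP S Act) (ρ : S → Act → S → ℝ) (σ : M.Strategy) (s : S) : Prop :=
  ∀ τ : M.Strategy, M.avgReward ρ τ s ≤ M.avgReward ρ σ s

end MDP

/-! ### Büchi automata -/

/-- A nondeterministic Büchi automaton with alphabet `α`, states `Q` and a set `acc` of accepting
transitions. -/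
structure BuchiAutomaton (α : Type w) (Q : Type x) where
  init : Q
  δ : Q → α → Set Q
  acc : Set (Q × α × Q)

/-- The words with a run that takes accepting transitions infinitely often (for finite `α` and `Q`,
this says that some accepting transition occurs infinitely often). -/
def BuchiAutomaton.language {α : Type w} {Q : Type x} (A : BuchiAutomaton α Q) : Set (ℕ → α) :=
  {w | ∃ r : ℕ → Q, r 0 = A.init ∧ (∀ i, r (i + 1) ∈ A.δ (r i) (w i)) ∧
    ∃ᶠ i in atTop, (r i, w i, r (i + 1)) ∈ A.acc}

/-- The word `u w`, for a finite word `u` and an infinite word `w`. -/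
def prependWord {α : Type w} (u : List α) (w : ℕ → α) : ℕ → α := fun n =>
  if h : n < u.length then u[n] else w (n - u.length)

/-- Absolute liveness: non-empty, and closed under adding arbitrary finite prefixes. -/
def IsAbsoluteLiveness {α : Type w} (L : Set (ℕ → α)) : Prop :=
  L.Nonempty ∧ ∀ (u : List α) (w : ℕ → α), w ∈ L → prependWord u w ∈ L

namespace LabelledMDP

variable {S : Type u} {Act : Type v} {AP : Type w} {Q : Type x}

/-- The (semantic) satisfaction probability of `A` under `σ` from `s`: the probability of the runs
whose word of labels is accepted by `A`. -/
noncomputable def semSat [Finite S] [Finite Act] (M : LabelledMDP S Act AP)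
    (A : BuchiAutomaton (Set AP) Q) (σ : M.Strategy) (s : S) : ℝ≥0∞ :=
  M.runMeasure σ s {z | (fun n => M.label (z n).state) ∈ A.language}

/-- The optimal satisfaction probability of `A` from `s`. -/
noncomputable def optSemSat [Finite S] [Finite Act] (M : LabelledMDP S Act AP)
    (A : BuchiAutomaton (Set AP) Q) (s : S) : ℝ≥0∞ :=
  ⨆ σ : M.Strategy, M.semSat A σ s

open Classical in
/-- The product `M × A`. The action `some (a, q')` selects the action `a` of `M` and the successor
`q'` of the automaton, which reads the label of the current state. In a state in which the automaton
has no transition, the only action is `none`, by which the run halts (it stays there forever and is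
not accepting). -/
noncomputable def prodAutomaton (M : LabelledMDP S Act AP) (A : BuchiAutomaton (Set AP) Q) :
    MDP (S × Q) (Option (Act × Q)) where
  avail p := {β | match β with
    | some (a, q') => a ∈ M.avail p.1 ∧ q' ∈ A.δ p.2 (M.label p.1)
    | none => A.δ p.2 (M.label p.1) = ∅}
  avail_nonempty := by
    rintro ⟨s, q⟩
    rcases Set.eq_empty_or_nonempty (A.δ q (M.label s)) with h | ⟨q', hq'⟩
    · exact ⟨none, h⟩
    · obtain ⟨a, ha⟩ := M.avail_nonempty s
      exact ⟨some (a, q'), ha, hq'⟩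
  T p β := match β with
    | some (a, q') => (M.T p.1 a).map fun s' => (s', q')
    | none => PMF.pure p

/-- The accepting steps of `M × A`. -/
def prodAcc (M : LabelledMDP S Act AP) (A : BuchiAutomaton (Set AP) Q) :
    Set (Step (S × Q) (Option (Act × Q))) :=
  {z | match z.action with
    | some (_, q') => (z.state.2, M.label z.state.1, q') ∈ A.acc
    | none => False}

/-- The optimal syntactic satisfaction probability from `s`: the supremum, over the strategies of
`M × A`, of the probability of the runs from `(s, q₀)` that are accepting. -/
noncomputable def optSynSat [Finite S] [Finite Act] [Finite Q] (M : LabelledMDP S Act AP)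
    (A : BuchiAutomaton (Set AP) Q) (s : S) : ℝ≥0∞ :=
  ⨆ σ : (M.prodAutomaton A).Strategy,
    (M.prodAutomaton A).runMeasure σ (s, A.init) {z | ∃ᶠ n in atTop, z n ∈ M.prodAcc A}

end LabelledMDP

/-- `A` is good for MDPs: the optimal syntactic and semantic satisfaction probabilities agree for
all finite MDPs and all starting states. -/
def BuchiAutomaton.IsGoodForMDPs.{u₁, v₁, w₁, x₁} {AP : Type w₁} {Q : Type x₁} [Finite Q]
    (A : BuchiAutomaton (Set AP) Q) : Prop :=
  ∀ (S : Type u₁) (Act : Type v₁) [Finite S] [Finite Act] (M : LabelledMDP S Act AP) (s : S),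
    M.optSynSat A s = M.optSemSat A s

/-! ### Reward machines -/

/-- A reward machine with alphabet `α` and states `U`, with nondeterministic transitions on letters,
one `ε`-transition from every state, and without a probabilistic component. In the reward
function, `none` stands for `ε`. -/
structure RewardMachine (α : Type w) (U : Type x) where
  init : U
  δ : U → α → Set U
  eps : U → U
  ρ : U → Option α → U → ℝ

open Classical in
/-- The reward machine of `A`: its transitions are those of `A`, an `ε`-transition resets to the
initial state with reward `c`, accepting transitions have reward `1` and all others `0`. -/
noncomputable def BuchiAutomaton.rewardMachine {α : Type w} {Q : Type x} (A : BuchiAutomaton α Q)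
    (c : ℝ) : RewardMachine α Q where
  init := A.init
  δ := A.δ
  eps _ := A.init
  ρ q l q' := match l with
    | none => c
    | some b => if (q, b, q') ∈ A.acc then 1 else 0

namespace LabelledMDP

variable {S : Type u} {Act : Type v} {AP : Type w} {U : Type x}

/-- The product `M × R`. The action `none` is `ε`: it takes the `ε`-transition of `R` and leaves the
state of `M` unchanged. It is available everywhere. -/
noncomputable def prodReward (M : LabelledMDP S Act AP) (R : RewardMachine (Set AP) U) :
    MDP (S × U) (Option (Act × U)) where
  avail p := {β | match β with
    | some (a, u') => a ∈ M.avail p.1 ∧ u' ∈ R.δ p.2 (M.label p.1)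
    | none => True}
  avail_nonempty _ := ⟨none, trivial⟩
  T p β := match β with
    | some (a, u') => (M.T p.1 a).map fun s' => (s', u')
    | none => PMF.pure (p.1, R.eps p.2)

/-- The reward function of `M × R`. -/
def prodRho (M : LabelledMDP S Act AP) (R : RewardMachine (Set AP) U) :
    S × U → Option (Act × U) → S × U → ℝ
  | p, some (_, u'), _ => R.ρ p.2 (some (M.label p.1)) u'
  | p, none, p' => R.ρ p.2 none p'.2

/-- A run of `M × R` satisfies `L` if it contains infinitely many moves of `M` and the word of the
labels of the states of `M` at these moves (the run without its `ε`-steps) is in `L`. -/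
def prodSatisfies (M : LabelledMDP S Act AP) (L : Set (ℕ → Set AP)) :
    Set (ℕ → Step (S × U) (Option (Act × U))) :=
  {z | {n | (z n).action ≠ none}.Infinite ∧
    (fun k => M.label (z (Nat.nth (fun n => (z n).action ≠ none) k)).state.1) ∈ L}

/-- The move of `M × R` that a positional strategy makes from `p` after at most one `ε`-step, if
there is one; `none` if it selects `ε` again. (In the product with the reward machine of an
automaton, all `ε`-transitions lead to one state, so that in this case it selects `ε` forever.) -/
def resolve {M : LabelledMDP S Act AP} {R : RewardMachine (Set AP) U}
    (π : (M.prodReward R).Positional) (p : S × U) : Option (Act × U) :=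
  match π.choose p with
  | some m => some m
  | none => π.choose (p.1, R.eps p.2)

/-- The state of the machine `R`, used as a finite memory, after a finite run of `M`: at each step
it is updated to the successor that `π` selects. -/
def memory {M : LabelledMDP S Act AP} {R : RewardMachine (Set AP) U}
    (π : (M.prodReward R).Positional) (h : List (Step S Act)) : U :=
  h.foldl (fun m z => match resolve π (z.state, m) with
    | some (_, u') => u'
    | none => R.init) R.init

/-- The pure finite-memory strategy of `M` that a positional strategy `π` of `M × R` induces: its
memory states are the states of `R`, and it plays the action of `M` that `π` selects. Where `π`
selects `ε` forever, an arbitrary available action is played. -/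
noncomputable def induced {M : LabelledMDP S Act AP} {R : RewardMachine (Set AP) U}
    (π : (M.prodReward R).Positional) : M.Strategy where
  choose h s := match resolve π (s, memory π h) with
    | some (a, _) => PMF.pure a
    | none => PMF.pure (M.avail_nonempty s).some
  support_subset := by
    intro h s a ha
    split at ha
    · rename_i b u' hb
      rw [PMF.support_pure, Set.mem_singleton_iff] at ha
      subst ha
      unfold resolve at hb
      split at hb
      · rename_i m hm
        have h1 := π.mem_avail (s, memory π h)
        rw [hm, hb] at h1
        exact h1.1
      · have h1 := π.mem_avail (s, R.eps (memory π h))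
        simp only at hb
        rw [hb] at h1
        exact h1.1
    · rw [PMF.support_pure, Set.mem_singleton_iff] at ha
      exact ha ▸ (M.avail_nonempty s).some_mem

end LabelledMDP

/-!
The theorem rests on one probabilistic fact, the first-step decomposition of the law of runs
(`MDP.runMeasure_eq_sum`): after the first step, a run follows the law of the shifted strategy. All
expectations and probabilities below are computed by recursion on it, and bounded by explicit
potentials: if a rank of the states decreases with probability at least `p` in each step, then
`rankPotential` decreases by at least `1` in expectation, so that the number of steps is bounded in
expectation by `stepBound p N`.

By `LabelledMDP.runMeasure_prodSatisfies_le`, a positional strategy `π` of the product with the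
reward machine satisfies the language with at most the probability of the induced strategy of `M`,
because unfolding a run of `M` along `π` maps the law of the one to the law of the other. As the
latter probability is at most the optimal one, it remains to show that an optimal `π` attains the
optimum. If the optimum is `0`, there is nothing to show.

Otherwise, as the automaton is good for MDPs, some strategy of `M × A` makes infinitely many
accepting steps with positive probability, so that a winning region can be reached, i.e. a set of
states in which accepting steps can be forced to recur (`MDP.exists_isWinningRegion`). Since `M` is
communicating, and since by absolute liveness the automaton can read every letter in its initial
state, resets and moves lead from every state of the product to this region; hence a positional
strategy has positive gain from everywhere (`LabelledMDP.exists_linear_reward`). So `π` cannot reach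
a state from which its total reward stays bounded: it would be better to switch there
(`MDP.Positional.not_isAvgOptimalFrom`). The total reward does stay bounded if no accepting step can
be reached, and also, for `c ≤ -stepBound p N`, if resets remain possible forever. Therefore `π`
almost surely reaches a region without resets in which accepting steps recur, and the labels that
are read after the last reset form an accepted word. By absolute liveness the whole word is
accepted.
-/

/-! ### Cylinder sets and the first-step decomposition of the law of runs -/

/-- Finite measures on sequences over a countable alphabet that agree on the cylinders of all finite
words are equal. -/
theorem MeasureTheory.Measure.ext_of_cylinder {Ω : Type*} [Countable Ω] [MeasurableSpace Ω]
    [DiscreteMeasurableSpace Ω] {μ ν : Measure (ℕ → Ω)} [IsFiniteMeasure μ] [IsFiniteMeasure ν]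
    (h : ∀ n (y : ℕ → Ω), μ {z | ∀ i < n, z i = y i} = ν {z | ∀ i < n, z i = y i}) : μ = ν := by
  have key : ∀ n, ν.map (Preorder.frestrictLe n) = μ.map (Preorder.frestrictLe n) := by
    intro n
    refine Measure.ext_of_singleton fun y => ?_
    rw [Measure.map_apply (by fun_prop) (measurableSet_singleton y),
      Measure.map_apply (by fun_prop) (measurableSet_singleton y)]
    -- The value of the word beyond `n` is irrelevant.
    have hy : (Preorder.frestrictLe (π := fun _ => Ω) n) ⁻¹' {y} = {z : ℕ → Ω | ∀ i < n + 1,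
        z i = if hi : i ≤ n then y ⟨i, by simpa using hi⟩ else y ⟨n, by simp⟩} := by
      ext z
      simp only [Set.mem_preimage, Set.mem_singleton_iff, Set.mem_ofPred_eq, funext_iff,
        Subtype.forall, Finset.mem_Iic, Preorder.frestrictLe_apply, Nat.lt_succ_iff]
      refine forall_congr' fun i => forall_congr' fun hi => ?_
      rw [dif_pos hi]
    rw [hy, h]
  have hμ : IsProjectiveMeasureFamily (fun I : Finset ℕ => μ.map I.restrict) := by
    intro I J hJ
    rw [Measure.map_map (by fun_prop) (by fun_prop)]
    rfl
  have h1 : IsProjectiveLimit ν (fun I : Finset ℕ => μ.map I.restrict) :=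
    (isProjectiveLimit_nat_iff hμ ν).2 fun n => key n
  have h2 : IsProjectiveLimit μ (fun I : Finset ℕ => μ.map I.restrict) := fun I => rfl
  have : ∀ I : Finset ℕ, IsFiniteMeasure (μ.map I.restrict) := fun I => inferInstance
  exact h2.unique h1

theorem measurableSet_cylinder {Ω : Type*} [MeasurableSpace Ω]
    [DiscreteMeasurableSpace Ω] (n : ℕ) (y : ℕ → Ω) :
    MeasurableSet {z : ℕ → Ω | ∀ i < n, z i = y i} := by
  have : {z : ℕ → Ω | ∀ i < n, z i = y i} = ⋂ i ∈ Set.Iio n, (fun z => z i) ⁻¹' {y i} := by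
    ext z; simp
  rw [this]
  exact MeasurableSet.biInter (Set.to_countable _) fun i _ =>
    measurable_pi_apply i (MeasurableSet.of_discrete)

/-- The run that begins with the step `z` and continues with `w`. -/
def consRun {Ω : Type*} (z : Ω) (w : ℕ → Ω) : ℕ → Ω
  | 0 => z
  | n + 1 => w n

@[simp] theorem consRun_zero {Ω : Type*} (z : Ω) (w : ℕ → Ω) : consRun z w 0 = z := rfl

@[simp] theorem consRun_succ {Ω : Type*} (z : Ω) (w : ℕ → Ω) (n : ℕ) :
    consRun z w (n + 1) = w n := rfl

@[fun_prop] theorem measurable_consRun {Ω : Type*} [MeasurableSpace Ω] (z : Ω) :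
    Measurable (consRun z) :=
  measurable_pi_lambda _ fun n => match n with
    | 0 => measurable_const
    | n + 1 => measurable_pi_apply n

theorem PMF.sum_coe {α : Type*} [Fintype α] (p : PMF α) : ∑ a, p a = 1 := by
  have h := p.tsum_coe
  rwa [tsum_fintype] at h

theorem PMF.map_stepMk_apply {S : Type*} {Act : Type*} (μ : PMF Act) (s : S) (y : Step S Act)
    [Decidable (y.state = s)] :
    μ.map (Step.mk s) y = if y.state = s then μ y.action else 0 := by
  classical
  rw [PMF.map_apply]
  obtain ⟨s', a⟩ := y
  by_cases h : s' = s
  · subst h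
    simp
  · simp [h]

namespace MDP

variable {S : Type u} {Act : Type v}

/-- The strategy that `σ` prescribes after the step `z`. -/
def Strategy.shift {M : MDP S Act} (σ : M.Strategy) (z : Step S Act) : M.Strategy where
  choose h s := σ.choose (z :: h) s
  support_subset h s := σ.support_subset (z :: h) s

instance [Finite S] [Finite Act] (M : MDP S Act) (σ : M.Strategy) (s : S) :
    IsProbabilityMeasure (M.runMeasure σ s) := by
  unfold runMeasure
  infer_instance

theorem nextStep_apply (M : MDP S Act) (σ : M.Strategy) (n : ℕ) (z : ℕ → Step S Act)
    (y : Step S Act) :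
    M.nextStep σ n (fun i => z i) y = M.T (z n).state (z n).action y.state *
      σ.choose (List.ofFn fun i : Fin (n + 1) => z i) y.state y.action := by
  classical
  unfold nextStep
  rw [PMF.bind_apply, tsum_eq_single y.state]
  · rw [PMF.map_stepMk_apply, if_pos rfl]
  · intro s hs
    rw [PMF.map_stepMk_apply, if_neg hs.symm, mul_zero]

variable [Fintype S] [Fintype Act]

theorem runMeasure_cylinder_one [DecidableEq S] (M : MDP S Act) (σ : M.Strategy) (s : S)
    (y : ℕ → Step S Act) :
    M.runMeasure σ s {z | ∀ i < 1, z i = y i} =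
      if (y 0).state = s then σ.choose [] s (y 0).action else 0 := by
  have e1 : {z : ℕ → Step S Act | ∀ i < 1, z i = y i} =
      Preorder.frestrictLe (π := fun _ => Step S Act) 0 ⁻¹' {fun i : Finset.Iic 0 => y i} := by
    ext z
    simp only [Set.mem_preimage, Set.mem_singleton_iff, funext_iff, Subtype.forall,
      Finset.mem_Iic, Preorder.frestrictLe_apply, Set.mem_ofPred_eq, Nat.lt_one_iff,
      Nat.le_zero]
  rw [e1, ← Measure.map_apply (by fun_prop) (measurableSet_singleton _), runMeasure,
    Kernel.trajMeasure, Measure.map_comp _ _ (by fun_prop), Kernel.traj_map_frestrictLe,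
    Kernel.partialTraj_self, Measure.id_comp,
    Measure.map_apply (by fun_prop) (measurableSet_singleton _), ← PMF.map_stepMk_apply]
  have e2 : (MeasurableEquiv.piUnique fun i : Finset.Iic 0 => Step S Act).symm ⁻¹'
      {fun i : Finset.Iic 0 => y i} = {y 0} := by
    ext z
    simp only [Set.mem_preimage, Set.mem_singleton_iff]
    constructor
    · intro h
      exact congrFun h ⟨0, by simp⟩
    · rintro rfl
      rw [MeasurableEquiv.symm_apply_eq]
      rfl
  rw [← PMF.toMeasure_apply_singleton _ _ (measurableSet_singleton _)]
  exact congrArg _ e2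

theorem runMeasure_cylinder_succ (M : MDP S Act) (σ : M.Strategy) (s : S)
    (n : ℕ) (y : ℕ → Step S Act) :
    M.runMeasure σ s {z | ∀ i < n + 2, z i = y i} =
      M.runMeasure σ s {z | ∀ i < n + 1, z i = y i} *
        (M.T (y n).state (y n).action (y (n + 1)).state *
      σ.choose (List.ofFn fun i : Fin (n + 1) => y i) (y (n + 1)).state (y (n + 1)).action) := by
  have h := Kernel.map_frestrictLe_trajMeasure_compProd_eq_map_trajMeasure
    (X := fun _ => Step S Act) (μ₀ := ((σ.choose [] s).map (Step.mk s)).toMeasure)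
    (κ := M.stepKernel σ) (a := n)
  have h2 := congrArg (fun μ => μ {((fun i : Finset.Iic n => y i), y (n + 1))}) h
  beta_reduce at h2
  rw [Measure.map_apply (by fun_prop) (measurableSet_singleton _)] at h2
  have e1 : ((fun x : ℕ → Step S Act => (Preorder.frestrictLe n x, x (n + 1))) ⁻¹'
      {((fun i : Finset.Iic n => y i), y (n + 1))}) = {z | ∀ i < n + 2, z i = y i} := by
    ext z
    simp only [Set.mem_preimage, Set.mem_singleton_iff, Prod.mk.injEq, funext_iff, Subtype.forall,
      Finset.mem_Iic, Preorder.frestrictLe_apply, Set.mem_ofPred_eq]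
    constructor
    · rintro ⟨h1, h2⟩ i hi
      rcases Nat.lt_succ_iff_lt_or_eq.1 hi with h | h
      · exact h1 i (by omega)
      · rw [h]; exact h2
    · intro h
      exact ⟨fun i hi => h i (by omega), h _ (by omega)⟩
  rw [e1] at h2
  change _ = M.runMeasure σ s _ at h2
  rw [← h2, ← Set.singleton_prod_singleton, Measure.compProd_apply_prod
    (measurableSet_singleton _) (measurableSet_singleton _), lintegral_singleton,
    Measure.map_apply (by fun_prop) (measurableSet_singleton _)]
  have e2 : Preorder.frestrictLe (π := fun _ => Step S Act) n ⁻¹' {fun i : Finset.Iic n => y i} =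
      {z | ∀ i < n + 1, z i = y i} := by
    ext z
    simp only [Set.mem_preimage, Set.mem_singleton_iff, funext_iff, Subtype.forall,
      Finset.mem_Iic, Preorder.frestrictLe_apply, Set.mem_ofPred_eq, Nat.lt_succ_iff]
  rw [e2, mul_comm]
  congr 1
  change (M.nextStep σ n fun i => y i).toMeasure {y (n + 1)} = _
  rw [PMF.toMeasure_apply_singleton _ _ (measurableSet_singleton _), nextStep_apply]

/-- `runMeasure_cylinder_succ` appends a last step to a cylinder; here the first step is split
off. -/
theorem runMeasure_cylinder_cons [DecidableEq S] (M : MDP S Act) (σ : M.Strategy) (s : S)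
    (n : ℕ) (y : ℕ → Step S Act) :
    M.runMeasure σ s {z | ∀ i < n + 1, z i = y i} =
      if (y 0).state = s then σ.choose [] s (y 0).action * ∑ t, M.T s (y 0).action t *
        M.runMeasure (σ.shift (y 0)) t {z | ∀ i < n, z i = y (i + 1)} else 0 := by
  have hsum : ∀ (a : Act) (f : S → ℝ≥0∞) (t₀ : S), (∑ t, M.T s a t *
      if t₀ = t then f t else 0) = M.T s a t₀ * f t₀ := fun a f t₀ => by simp
  induction n with
  | zero =>
    have h1 : ∀ t, M.runMeasure (σ.shift (y 0)) t {z | ∀ i < 0, z i = y (i + 1)} = 1 := fun t => by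
      simp
    have h2 : ∑ t, M.T s (y 0).action t = 1 := PMF.sum_coe _
    rw [runMeasure_cylinder_one]
    simp only [h1, mul_one, h2]
  | succ n ih =>
    rw [runMeasure_cylinder_succ]
    split_ifs with hs
    · cases n with
      | zero =>
        rw [runMeasure_cylinder_one, if_pos hs]
        have h1 : ∀ t, M.runMeasure (σ.shift (y 0)) t {z | ∀ i < 0 + 1, z i = y (i + 1)} = _ :=
          fun t => runMeasure_cylinder_one M (σ.shift (y 0)) t (fun i => y (i + 1))
        simp only [h1]
        rw [hsum (y 0).action (fun t => (σ.shift (y 0)).choose [] t (y (0 + 1)).action), hs]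
        simp [Strategy.shift]
      | succ n =>
        rw [ih, if_pos hs]
        have h1 : ∀ t, M.runMeasure (σ.shift (y 0)) t {z | ∀ i < n + 1 + 1, z i = y (i + 1)} = _ :=
          fun t => runMeasure_cylinder_succ M (σ.shift (y 0)) t n (fun i => y (i + 1))
        simp only [h1]
        rw [mul_assoc, Finset.sum_mul]
        congr 1
        refine Finset.sum_congr rfl fun t _ => ?_
        rw [List.ofFn_succ]
        simp only [mul_assoc, Strategy.shift, Fin.val_zero, Fin.val_succ]
    · rw [ih, if_neg hs, zero_mul]

/-- The first-step decomposition: after the first step `⟨s, a⟩` and the move to `t`, the rest of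
the run follows the law of the shifted strategy from `t`. -/
theorem runMeasure_eq_sum (M : MDP S Act) (σ : M.Strategy) (s : S) :
    M.runMeasure σ s = ∑ a, ∑ t, (σ.choose [] s a * M.T s a t) •
      (M.runMeasure (σ.shift ⟨s, a⟩) t).map (consRun ⟨s, a⟩) := by
  classical
  have : IsFiniteMeasure (∑ a, ∑ t, (σ.choose [] s a * M.T s a t) •
      (M.runMeasure (σ.shift ⟨s, a⟩) t).map (consRun ⟨s, a⟩)) := by
    constructor
    simp only [Measure.coe_finsetSum, Finset.sum_apply, Measure.smul_apply, smul_eq_mul,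
      Measure.map_apply (measurable_consRun _) MeasurableSet.univ, Set.preimage_univ,
      measure_univ, mul_one]
    simp only [← Finset.mul_sum, PMF.sum_coe, mul_one]
    exact ENNReal.one_lt_top
  refine Measure.ext_of_cylinder fun n y => ?_
  simp only [Measure.coe_finsetSum, Finset.sum_apply, Measure.smul_apply, smul_eq_mul,
      Measure.map_apply (measurable_consRun _) (measurableSet_cylinder n y)]
  cases n with
  | zero => simp [← Finset.mul_sum, PMF.sum_coe]
  | succ n =>
    have h3 : ∀ a, consRun (Step.mk s a) ⁻¹' {z | ∀ i < n + 1, z i = y i} =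
        {z | y 0 = ⟨s, a⟩ ∧ ∀ i < n, z i = y (i + 1)} := by
      intro a
      ext z
      simp only [Set.mem_preimage, Set.mem_ofPred_eq]
      constructor
      · intro h
        exact ⟨(h 0 (by omega)).symm, fun i hi => h (i + 1) (by omega)⟩
      · rintro ⟨h, h'⟩ i hi
        cases i with
        | zero => exact h.symm
        | succ i => exact h' i (by omega)
    simp only [h3]
    rw [runMeasure_cylinder_cons]
    split_ifs with hs
    · have hy : y 0 = ⟨s, (y 0).action⟩ := by rw [← hs]
      rw [Finset.sum_eq_single (y 0).action, Finset.mul_sum]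
      · refine Finset.sum_congr rfl fun t _ => ?_
        rw [mul_assoc, ← hy]
        simp
      · intro a _ ha
        refine Finset.sum_eq_zero fun t _ => ?_
        have : y 0 ≠ ⟨s, a⟩ := fun h => ha (by rw [h])
        simp [this]
      · simp
    · symm
      refine Finset.sum_eq_zero fun a _ => Finset.sum_eq_zero fun t _ => ?_
      have : y 0 ≠ ⟨s, a⟩ := fun h => hs (by rw [h])
      simp [this]

end MDP

/-! ### Consequences of the first-step decomposition -/

namespace MDP

variable {S : Type u} {Act : Type v}

theorem measurableSet_step (n : ℕ) (p : Step S Act → Prop) :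
    MeasurableSet {z : ℕ → Step S Act | p (z n)} :=
  measurable_pi_apply n (MeasurableSet.of_discrete (s := {x | p x}))

theorem measurableSet_step₂ [Finite S] [Finite Act] (m n : ℕ) (p : Step S Act → Step S Act → Prop) :
    MeasurableSet {z : ℕ → Step S Act | p (z m) (z n)} :=
  (by fun_prop : Measurable fun z : ℕ → Step S Act => (z m, z n))
    (MeasurableSet.of_discrete (s := {x : Step S Act × Step S Act | p x.1 x.2}))

variable [Fintype S] [Fintype Act]

theorem runMeasure_apply (M : MDP S Act) (σ : M.Strategy) (s : S) {B : Set (ℕ → Step S Act)}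
    (hB : MeasurableSet B) :
    M.runMeasure σ s B = ∑ a, ∑ t, σ.choose [] s a * M.T s a t *
      M.runMeasure (σ.shift ⟨s, a⟩) t (consRun ⟨s, a⟩ ⁻¹' B) := by
  conv_lhs => rw [runMeasure_eq_sum]
  simp only [Measure.coe_finsetSum, Finset.sum_apply, Measure.smul_apply, smul_eq_mul,
    Measure.map_apply (measurable_consRun _) hB]

theorem ae_runMeasure (M : MDP S Act) (σ : M.Strategy) (s : S) {p : (ℕ → Step S Act) → Prop}
    (hp : MeasurableSet {z | p z})
    (h : ∀ a t, σ.choose [] s a ≠ 0 → M.T s a t ≠ 0 →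
      ∀ᵐ w ∂M.runMeasure (σ.shift ⟨s, a⟩) t, p (consRun ⟨s, a⟩ w)) :
    ∀ᵐ z ∂M.runMeasure σ s, p z := by
  rw [ae_iff]
  have hm : MeasurableSet {z | ¬ p z} := hp.compl
  rw [runMeasure_apply M σ s hm]
  refine Finset.sum_eq_zero fun a _ => Finset.sum_eq_zero fun t _ => ?_
  by_cases ha : σ.choose [] s a = 0
  · simp [ha]
  by_cases ht : M.T s a t = 0
  · simp [ht]
  rw [show M.runMeasure (σ.shift ⟨s, a⟩) t (consRun ⟨s, a⟩ ⁻¹' {z | ¬ p z}) = 0 from h a t ha ht,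
    mul_zero]

theorem ae_state_zero (M : MDP S Act) (σ : M.Strategy) (s : S) :
    ∀ᵐ z ∂M.runMeasure σ s, (z 0).state = s :=
  ae_runMeasure M σ s (measurableSet_step 0 fun x => x.state = s) fun a t _ _ => by simp

/-- Almost surely, all steps use actions that the strategy can select, and move along transitions
of positive probability. -/
theorem ae_steps (M : MDP S Act) {Q : S → Act → Prop} (σ : M.Strategy)
    (hσ : ∀ h s a, σ.choose h s a ≠ 0 → Q s a) (s : S) :
    ∀ᵐ z ∂M.runMeasure σ s, ∀ n, Q (z n).state (z n).action ∧
      M.T (z n).state (z n).action (z (n + 1)).state ≠ 0 := by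
  rw [ae_all_iff]
  intro n
  induction n generalizing σ s with
  | zero =>
    refine ae_runMeasure M σ s (measurableSet_step₂ 0 (0 + 1) fun x y => Q x.state x.action ∧
      M.T x.state x.action y.state ≠ 0) fun a t ha ht => ?_
    filter_upwards [ae_state_zero M (σ.shift ⟨s, a⟩) t] with w hw
    rw [consRun_zero, consRun_succ, hw]
    exact ⟨hσ _ _ _ ha, ht⟩
  | succ n ih =>
    refine ae_runMeasure M σ s (measurableSet_step₂ (n + 1) (n + 1 + 1) fun x y =>
      Q x.state x.action ∧ M.T x.state x.action y.state ≠ 0) fun a t _ _ => ?_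
    exact ih (σ.shift ⟨s, a⟩) (fun h => hσ _) t

/-- `t` is reached from `s` with positive probability by an action that satisfies `Q`. -/
def Edge (M : MDP S Act) (Q : S → Act → Prop) (s t : S) : Prop := ∃ a, Q s a ∧ M.T s a t ≠ 0

theorem ae_reflTransGen (M : MDP S Act) {Q : S → Act → Prop} (σ : M.Strategy)
    (hσ : ∀ h s a, σ.choose h s a ≠ 0 → Q s a) (s : S) :
    ∀ᵐ z ∂M.runMeasure σ s, ∀ n, Relation.ReflTransGen (M.Edge Q) s (z n).state := by
  filter_upwards [ae_steps M σ hσ s, ae_state_zero M σ s] with z hz h0 n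
  induction n with
  | zero => rw [h0]
  | succ n ih => exact ih.tail ⟨_, hz n⟩

theorem IsCommunicating.reflTransGen {M : MDP S Act} (hM : M.IsCommunicating) (s s' : S) :
    Relation.ReflTransGen (M.Edge fun s a => a ∈ M.avail s) s s' := by
  obtain ⟨σ, hσ⟩ := hM s s'
  by_contra hcon
  refine hσ.ne' ?_
  have := ae_reflTransGen M (Q := fun s a => a ∈ M.avail s) σ
    (fun h s a ha => σ.support_subset h s ha) s
  refine measure_mono_null ?_ this
  rintro z ⟨n, hn⟩ hz
  exact hcon (hn ▸ hz n)

/-! ### Expected total rewards -/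

/-- The expected total reward of the first `n` steps. -/
noncomputable def expReward (M : MDP S Act) (ρ : S → Act → S → ℝ) (σ : M.Strategy) (n : ℕ)
    (s : S) : ℝ :=
  ∫ z, ∑ i ∈ Finset.range n, ρ (z i).state (z i).action (z (i + 1)).state ∂(M.runMeasure σ s)

theorem measurable_totalReward (ρ : S → Act → S → ℝ) (n : ℕ) :
    Measurable fun z : ℕ → Step S Act =>
      ∑ i ∈ Finset.range n, ρ (z i).state (z i).action (z (i + 1)).state :=
  Finset.measurable_sum _ fun i _ =>
    (Measurable.of_discrete (f := fun p : Step S Act × Step S Act =>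
      ρ p.1.state p.1.action p.2.state)).comp
      (by fun_prop : Measurable fun z : ℕ → Step S Act => (z i, z (i + 1)))

theorem exists_bound_reward (ρ : S → Act → S → ℝ) :
    ∃ K, 0 ≤ K ∧ ∀ s a t, |ρ s a t| ≤ K := by
  obtain ⟨K, hK⟩ := (Set.finite_range fun x : S × Act × S => |ρ x.1 x.2.1 x.2.2|).bddAbove
  exact ⟨max K 0, le_max_right _ _, fun s a t => (hK ⟨(s, a, t), rfl⟩).trans (le_max_left _ _)⟩

theorem integrable_totalReward (ρ : S → Act → S → ℝ) (n : ℕ) (μ : Measure (ℕ → Step S Act))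
    [IsFiniteMeasure μ] :
    Integrable (fun z : ℕ → Step S Act =>
      ∑ i ∈ Finset.range n, ρ (z i).state (z i).action (z (i + 1)).state) μ := by
  obtain ⟨K, hK0, hK⟩ := exists_bound_reward ρ
  refine Integrable.of_bound (measurable_totalReward ρ n).aestronglyMeasurable (n * K)
    (Eventually.of_forall fun z => ?_)
  rw [Real.norm_eq_abs]
  refine (Finset.abs_sum_le_sum_abs _ _).trans ((Finset.sum_le_sum fun i _ => hK _ _ _).trans ?_)
  simp

theorem _root_.PMF.sum_toReal {α : Type*} [Fintype α] (p : PMF α) : ∑ a, (p a).toReal = 1 := by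
  rw [← ENNReal.toReal_sum fun a _ => p.apply_ne_top a, PMF.sum_coe, ENNReal.toReal_one]

theorem expReward_zero (M : MDP S Act) (ρ : S → Act → S → ℝ) (σ : M.Strategy) (s : S) :
    M.expReward ρ σ 0 s = 0 := by simp [expReward]

theorem expReward_succ (M : MDP S Act) (ρ : S → Act → S → ℝ) (σ : M.Strategy) (n : ℕ) (s : S) :
    M.expReward ρ σ (n + 1) s = ∑ a, (σ.choose [] s a).toReal *
      ∑ t, (M.T s a t).toReal * (ρ s a t + M.expReward ρ (σ.shift ⟨s, a⟩) n t) := by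
  unfold expReward
  conv_lhs => rw [runMeasure_eq_sum]
  have hf : ∀ a t, IsFiniteMeasure ((σ.choose [] s a * M.T s a t) •
      (M.runMeasure (σ.shift ⟨s, a⟩) t).map (consRun ⟨s, a⟩)) := fun a t =>
    Measure.smul_finite _ (ENNReal.mul_ne_top (PMF.apply_ne_top _ _) (PMF.apply_ne_top _ _))
  rw [integral_finsetSum_measure fun a _ => integrable_totalReward _ _ _]
  refine Finset.sum_congr rfl fun a _ => ?_
  rw [integral_finsetSum_measure fun t _ => integrable_totalReward _ _ _, Finset.mul_sum]
  refine Finset.sum_congr rfl fun t _ => ?_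
  rw [integral_smul_measure, integral_map (by fun_prop)
    (measurable_totalReward ρ _).aestronglyMeasurable, ENNReal.toReal_mul, smul_eq_mul, mul_assoc]
  congr 2
  simp only [Finset.sum_range_succ' _ n, consRun_succ, consRun_zero]
  rw [integral_add (integrable_totalReward _ _ _)
    (Integrable.of_bound (C := |ρ s a t|) ?_ ?_), add_comm]
  · congr 1
    rw [integral_congr_ae (g := fun _ => ρ s a t)]
    · simp
    · filter_upwards [ae_state_zero M (σ.shift ⟨s, a⟩) t] with w hw
      rw [hw]
  · exact ((Measurable.of_discrete (f := fun p : Step S Act => ρ s a p.state)).comp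
      (measurable_pi_apply 0)).aestronglyMeasurable
  · filter_upwards [ae_state_zero M (σ.shift ⟨s, a⟩) t] with w hw
    rw [hw, Real.norm_eq_abs]

theorem expReward_neg (M : MDP S Act) (ρ : S → Act → S → ℝ) (σ : M.Strategy) (n : ℕ) (s : S) :
    M.expReward (fun s a t => - ρ s a t) σ n s = - M.expReward ρ σ n s := by
  simp [expReward, integral_neg]

/-- A nonnegative function `h` that, up to `g` per step, does not increase in expectation when
the collected reward is added bounds the expected total reward. -/
theorem expReward_le (M : MDP S Act) {ρ : S → Act → S → ℝ} {Q : S → Act → Prop} (σ : M.Strategy)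
    (hσ : ∀ h s a, σ.choose h s a ≠ 0 → Q s a) {C : Set S} {h : S → ℝ} {g : ℝ}
    (hC : ∀ s ∈ C, ∀ a, Q s a → ∀ t, M.T s a t ≠ 0 → t ∈ C) (h0 : ∀ s ∈ C, 0 ≤ h s)
    (hh : ∀ s ∈ C, ∀ a, Q s a → ∑ t, (M.T s a t).toReal * (ρ s a t + h t) ≤ g + h s)
    (n : ℕ) (s : S) (hs : s ∈ C) : M.expReward ρ σ n s ≤ n * g + h s := by
  induction n generalizing σ s with
  | zero => simpa [expReward_zero] using h0 s hs
  | succ n ih =>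
    rw [expReward_succ, ← one_mul (_ + h s), ← PMF.sum_toReal (σ.choose [] s), Finset.sum_mul]
    refine Finset.sum_le_sum fun a _ => ?_
    by_cases ha : σ.choose [] s a = 0
    · simp [ha]
    have hQ := hσ _ _ _ ha
    refine mul_le_mul_of_nonneg_left ?_ ENNReal.toReal_nonneg
    have h1 : ∑ t, (M.T s a t).toReal * (ρ s a t + M.expReward ρ (σ.shift ⟨s, a⟩) n t) ≤
        ∑ t, ((M.T s a t).toReal * (ρ s a t + h t) + (M.T s a t).toReal * (n * g)) := by
      refine Finset.sum_le_sum fun t _ => ?_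
      by_cases ht : M.T s a t = 0
      · simp [ht]
      have h2 := ih (σ.shift ⟨s, a⟩) (fun h => hσ _) t (hC s hs a hQ t ht)
      rw [← mul_add]
      exact mul_le_mul_of_nonneg_left (by linarith) ENNReal.toReal_nonneg
    rw [Finset.sum_add_distrib, ← Finset.sum_mul, PMF.sum_toReal] at h1
    have h3 := hh s hs a hQ
    push_cast
    linarith

theorem le_expReward (M : MDP S Act) {ρ : S → Act → S → ℝ} {Q : S → Act → Prop} (σ : M.Strategy)
    (hσ : ∀ h s a, σ.choose h s a ≠ 0 → Q s a) {h : S → ℝ} {g : ℝ} (h0 : ∀ s, 0 ≤ h s)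
    (hh : ∀ s a, Q s a → g - h s ≤ ∑ t, (M.T s a t).toReal * (ρ s a t - h t))
    (n : ℕ) (s : S) : n * g - h s ≤ M.expReward ρ σ n s := by
  have := expReward_le M (ρ := fun s a t => - ρ s a t) σ hσ (C := Set.univ) (h := h) (g := -g)
    (fun _ _ _ _ _ _ => trivial) (fun s _ => h0 s) (fun s _ a ha => ?_) n s trivial
  · rw [expReward_neg] at this
    linarith
  · have h1 := hh s a ha
    have h2 : ∑ t, (M.T s a t).toReal * (-ρ s a t + h t) =
        - ∑ t, (M.T s a t).toReal * (ρ s a t - h t) := by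
      rw [← Finset.sum_neg_distrib]
      exact Finset.sum_congr rfl fun t _ => by ring
    linarith

theorem abs_expReward_le (M : MDP S Act) {ρ : S → Act → S → ℝ} {K : ℝ}
    (hK : ∀ s a t, |ρ s a t| ≤ K) (σ : M.Strategy) (n : ℕ) (s : S) :
    |M.expReward ρ σ n s| ≤ n * K := by
  have hs : ∀ s a, ∑ t, (M.T s a t).toReal * K = K := fun s a => by
    rw [← Finset.sum_mul, PMF.sum_toReal, one_mul]
  rw [abs_le]
  constructor
  · have := le_expReward M (ρ := ρ) (Q := fun _ _ => True) σ (fun _ _ _ _ => trivial)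
      (h := fun _ => 0) (g := -K) (fun _ => le_rfl) (fun s a _ => ?_) n s
    · linarith
    · rw [sub_zero, neg_le, ← Finset.sum_neg_distrib, ← hs s a]
      refine Finset.sum_le_sum fun t _ => ?_
      rw [← mul_neg]
      exact mul_le_mul_of_nonneg_left (by linarith [abs_le.1 (hK s a t)]) ENNReal.toReal_nonneg
  · have := expReward_le M (ρ := ρ) (Q := fun _ _ => True) σ (fun _ _ _ _ => trivial)
      (C := Set.univ) (h := fun _ => 0) (g := K) (fun _ _ _ _ _ _ => trivial)
      (fun _ _ => le_rfl) (fun s _ a _ => ?_) n s trivial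
    · linarith
    · rw [add_zero, ← hs s a]
      refine Finset.sum_le_sum fun t _ => ?_
      exact mul_le_mul_of_nonneg_left (by linarith [abs_le.1 (hK s a t)]) ENNReal.toReal_nonneg

/-- If the expected number of steps in `B` is bounded, almost surely there are finitely many. -/
theorem ae_not_frequently (M : MDP S Act) (σ : M.Strategy) (s : S) (B : Set (Step S Act)) {K : ℝ}
    (hK : ∀ n, M.expReward (fun s a _ => B.indicator 1 ⟨s, a⟩) σ n s ≤ K) :
    M.runMeasure σ s {z | ∃ᶠ n in atTop, z n ∈ B} = 0 := by
  refine measure_setOfPred_frequently_eq_zero ?_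
  refine ne_top_of_le_ne_top (b := ENNReal.ofReal K) ENNReal.ofReal_ne_top ?_
  refine ENNReal.tsum_le_of_sum_range_le fun n => ?_
  refine ENNReal.le_ofReal_iff_toReal_le ?_ ?_ |>.2 ?_
  · exact ENNReal.sum_ne_top.2 fun i _ => measure_ne_top _ _
  · simpa [expReward_zero] using hK 0
  refine le_trans (le_of_eq ?_) (hK n)
  rw [ENNReal.toReal_sum fun i _ => measure_ne_top _ _, expReward, integral_finsetSum]
  · refine Finset.sum_congr rfl fun i _ => ?_
    have : (fun z : ℕ → Step S Act => B.indicator (1 : Step S Act → ℝ)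
        ⟨(z i).state, (z i).action⟩) = {z : ℕ → Step S Act | z i ∈ B}.indicator 1 := by
      ext z
      rfl
    rw [this, integral_indicator_one (measurableSet_step i fun x => x ∈ B)]
    rfl
  · intro i _
    refine Integrable.of_bound (C := 1) ?_ (Eventually.of_forall fun z => ?_)
    · exact ((Measurable.of_discrete (f := fun p : Step S Act => B.indicator (1 : Step S Act → ℝ)
        ⟨p.state, p.action⟩)).comp (measurable_pi_apply i)).aestronglyMeasurable
    · classical
      rw [Real.norm_eq_abs, Set.indicator_apply]
      split_ifs <;> simp

end MDP

/-! ### Ranks and potentials -/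

/-- Every rank function on a finite type can be replaced by one with values at most the
cardinality: take the number of ranks below. -/
theorem exists_bounded_rank {X : Type*} [Fintype X] (d : X → ℕ) :
    ∃ d' : X → ℕ, (∀ x, d' x ≤ Fintype.card X) ∧ ∀ x y, (d y < d x → d' y < d' x) ∧
      (d y ≤ d x → d' y ≤ d' x) := by
  classical
  refine ⟨fun x => ((Finset.univ.image d).filter (· < d x)).card, fun x => ?_, fun x y => ⟨?_, ?_⟩⟩
  · exact (Finset.card_filter_le _ _).trans Finset.card_image_le
  · intro h
    refine Finset.card_lt_card ((Finset.ssubset_iff_of_subset ?_).2 ⟨d y, ?_, ?_⟩)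
    · intro k hk
      rw [Finset.mem_filter] at hk ⊢
      exact ⟨hk.1, hk.2.trans h⟩
    · simp [h]
    · simp
  · intro h
    refine Finset.card_le_card ?_
    intro k hk
    rw [Finset.mem_filter] at hk ⊢
    exact ⟨hk.1, hk.2.trans_le h⟩

/-- The distance to `G` along `R`, as a bounded rank function. -/
theorem exists_distance {X : Type*} [Fintype X] (R : X → X → Prop) (G : Set X) :
    ∃ d : X → ℕ, (∀ x, d x ≤ Fintype.card X) ∧ ∀ x ∉ G, (∃ g ∈ G, Relation.ReflTransGen R x g) →
      ∃ y, R x y ∧ d y < d x ∧ ∃ g ∈ G, Relation.ReflTransGen R y g := by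
  -- `reach n x`: some path of length `n` leads from `x` to `G`.
  let reach : ℕ → X → Prop := fun n => Nat.rec (fun x => x ∈ G) (fun _ r x => ∃ y, R x y ∧ r y) n
  have h1 : ∀ n x, reach n x → ∃ g ∈ G, Relation.ReflTransGen R x g := by
    intro n
    induction n with
    | zero => exact fun x hx => ⟨x, hx, .refl⟩
    | succ n ih =>
      rintro x ⟨y, hxy, hy⟩
      obtain ⟨g, hg, h⟩ := ih y hy
      exact ⟨g, hg, h.head hxy⟩
  have h2 : ∀ x, (∃ g ∈ G, Relation.ReflTransGen R x g) → ∃ n, reach n x := by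
    rintro x ⟨g, hg, h⟩
    induction h using Relation.ReflTransGen.head_induction_on with
    | refl => exact ⟨0, hg⟩
    | head hxy _ ih =>
      obtain ⟨n, hn⟩ := ih
      exact ⟨n + 1, _, hxy, hn⟩
  obtain ⟨d', hd', hlt⟩ := exists_bounded_rank fun x => sInf {n | reach n x}
  refine ⟨d', hd', fun x hx hxg => ?_⟩
  have hmem : reach (sInf {n | reach n x}) x := Nat.sInf_mem (h2 x hxg)
  rcases hk : sInf {n | reach n x} with _ | k
  · rw [hk] at hmem
    exact absurd hmem hx
  · rw [hk] at hmem
    obtain ⟨y, hxy, hy⟩ := hmem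
    refine ⟨y, hxy, (hlt x y).1 ?_, h1 k y hy⟩
    rw [hk]
    exact Nat.lt_succ_of_le (Nat.sInf_le hy)

/-- The solution of `t 0 = 0`, `p * t (k + 1) = 1 + t k`: a bound for the expected number of steps
until `k` successive successes occur, each of which has probability at least `p`. -/
noncomputable def stepBound (p : ℝ) : ℕ → ℝ
  | 0 => 0
  | k + 1 => (1 + stepBound p k) / p

/-- The potential of the rank `r ≤ N`. If in a step the rank decreases with probability at least
`p` (and becomes at most `N` otherwise), the expected potential decreases by at least `1`. -/
noncomputable def rankPotential (p : ℝ) (N r : ℕ) : ℝ := stepBound p N - stepBound p (N - r)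

section potential

variable {p : ℝ} (hp : 0 < p) (hp1 : p ≤ 1)
include hp

theorem stepBound_nonneg (k : ℕ) : 0 ≤ stepBound p k := by
  induction k with
  | zero => exact le_rfl
  | succ k ih => exact div_nonneg (by linarith) hp.le

theorem rankPotential_le_stepBound (N r : ℕ) : rankPotential p N r ≤ stepBound p N :=
  sub_le_self _ (stepBound_nonneg hp _)

include hp1

theorem stepBound_mono : Monotone (stepBound p) := by
  refine monotone_nat_of_le_succ fun k => ?_
  rw [stepBound, le_div_iff₀ hp]
  nlinarith [stepBound_nonneg hp k]

theorem rankPotential_mono (N : ℕ) : Monotone (rankPotential p N) := fun _ _ h =>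
  sub_le_sub_left (stepBound_mono hp hp1 (Nat.sub_le_sub_left h N)) _

theorem rankPotential_nonneg (N r : ℕ) : 0 ≤ rankPotential p N r :=
  sub_nonneg.2 (stepBound_mono hp hp1 (Nat.sub_le N r))

theorem sum_rankPotential_le {X : Type*} [Fintype X] {μ : PMF X} {d : X → ℕ} {N r : ℕ}
    (h : ∀ y, μ y ≠ 0 → d y ≤ r) :
    ∑ y, (μ y).toReal * rankPotential p N (d y) ≤ rankPotential p N r := by
  rw [← one_mul (rankPotential p N r), ← PMF.sum_toReal μ, Finset.sum_mul]
  refine Finset.sum_le_sum fun y _ => ?_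
  by_cases hy : μ y = 0
  · simp [hy]
  · exact mul_le_mul_of_nonneg_left (rankPotential_mono hp hp1 N (h y hy)) ENNReal.toReal_nonneg

theorem one_add_sum_rankPotential_le {X : Type*} [Fintype X] {μ : PMF X} {d : X → ℕ} {N r : ℕ}
    (hr : r ≤ N) (y : X) (hy : d y < r) (hpy : p ≤ (μ y).toReal) :
    1 + ∑ y, (μ y).toReal * rankPotential p N (d y) ≤ rankPotential p N r := by
  classical
  have h1 : ∑ y, (μ y).toReal * (stepBound p N - rankPotential p N (d y)) =
      stepBound p N - ∑ y, (μ y).toReal * rankPotential p N (d y) := by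
    simp only [mul_sub, Finset.sum_sub_distrib]
    rw [← Finset.sum_mul, PMF.sum_toReal, one_mul]
  have h2 : (μ y).toReal * (stepBound p N - rankPotential p N (d y)) ≤
      ∑ y, (μ y).toReal * (stepBound p N - rankPotential p N (d y)) :=
    Finset.single_le_sum (f := fun y => (μ y).toReal * (stepBound p N - rankPotential p N (d y)))
      (fun z _ => mul_nonneg ENNReal.toReal_nonneg
        (sub_nonneg.2 (rankPotential_le_stepBound hp _ _))) (Finset.mem_univ y)
  have h3 : stepBound p (N - r + 1) ≤ stepBound p N - rankPotential p N (d y) := by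
    rw [rankPotential, sub_sub_cancel]
    exact stepBound_mono hp hp1 (by omega)
  have h4 : p * stepBound p (N - r + 1) = 1 + stepBound p (N - r) := by
    rw [stepBound, mul_div_cancel₀ _ hp.ne']
  have h5 : p * stepBound p (N - r + 1) ≤
      (μ y).toReal * (stepBound p N - rankPotential p N (d y)) :=
    mul_le_mul hpy h3 (stepBound_nonneg hp _) ENNReal.toReal_nonneg
  rw [rankPotential]
  linarith

end potential

namespace MDP

variable {S : Type u} {Act : Type v}

theorem exists_minProb [Fintype S] [Fintype Act] (M : MDP S Act) :
    ∃ p : ℝ, 0 < p ∧ p ≤ 1 ∧ ∀ s a t, M.T s a t ≠ 0 → p ≤ (M.T s a t).toReal := by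
  classical
  let f : S × Act × S → ℝ := fun x =>
    if M.T x.1 x.2.1 x.2.2 = 0 then 1 else (M.T x.1 x.2.1 x.2.2).toReal
  have hf : ∀ x, 0 < f x := by
    intro x
    simp only [f]
    split_ifs with h
    · exact one_pos
    · exact ENNReal.toReal_pos h (PMF.apply_ne_top _ _)
  have hle : ∀ s a t, M.T s a t ≠ 0 → f (s, a, t) = (M.T s a t).toReal := fun s a t h => by
    simp [f, h]
  rcases isEmpty_or_nonempty (S × Act × S) with hE | hE
  · exact ⟨1, one_pos, le_rfl, fun s a t => (hE.false (s, a, t)).elim⟩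
  · obtain ⟨x, hx⟩ := Finite.exists_min f
    refine ⟨min (f x) 1, lt_min (hf x) one_pos, min_le_right _ _, fun s a t h => ?_⟩
    rw [← hle s a t h]
    exact (min_le_left _ _).trans (hx _)

/-! ### Recurrence in the Markov chain of a positional strategy -/

/-- The one-step relation of the Markov chain of `π`. -/
def Positional.Edge {M : MDP S Act} (π : M.Positional) (s t : S) : Prop :=
  M.T s (π.choose s) t ≠ 0

theorem Positional.toStrategy_ne_zero {M : MDP S Act} (π : M.Positional) (h : List (Step S Act))
    (s : S) (a : Act) (ha : π.toStrategy.choose h s a ≠ 0) : a = π.choose s := by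
  have : a ∈ (PMF.pure (π.choose s)).support := ha
  rwa [PMF.support_pure, Set.mem_singleton_iff] at this

theorem Positional.sum_toStrategy [Fintype Act] {M : MDP S Act} (π : M.Positional) (s : S)
    (f : Act → ℝ) :
    ∑ a, (π.toStrategy.choose [] s a).toReal * f a = f (π.choose s) := by
  classical
  have : ∀ a, (π.toStrategy.choose [] s a).toReal = if a = π.choose s then 1 else 0 := by
    intro a
    change (PMF.pure (π.choose s) a).toReal = _
    rw [PMF.pure_apply]
    split_ifs <;> simp
  simp [this]

variable [Fintype S] [Fintype Act]

theorem Positional.expReward_succ {M : MDP S Act} (π : M.Positional) (ρ : S → Act → S → ℝ)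
    (n : ℕ) (s : S) : M.expReward ρ π.toStrategy (n + 1) s =
      ∑ t, (M.T s (π.choose s) t).toReal *
        (ρ s (π.choose s) t + M.expReward ρ π.toStrategy n t) := by
  rw [MDP.expReward_succ]
  exact π.sum_toStrategy s fun a => ∑ t, (M.T s a t).toReal *
        (ρ s a t + M.expReward ρ π.toStrategy n t)

theorem Positional.runMeasure_real {M : MDP S Act} (π : M.Positional) (s : S)
    {B : Set (ℕ → Step S Act)} (hB : MeasurableSet B) :
    (M.runMeasure π.toStrategy s).real B = ∑ t, (M.T s (π.choose s) t).toReal *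
      (M.runMeasure π.toStrategy t).real (consRun ⟨s, π.choose s⟩ ⁻¹' B) := by
  rw [Measure.real, runMeasure_apply M _ s hB,
    ← π.sum_toStrategy s fun a => ∑ t, (M.T s a t).toReal *
      (M.runMeasure π.toStrategy t).real (consRun ⟨s, a⟩ ⁻¹' B)]
  have hfin : ∀ a t, π.toStrategy.choose [] s a * M.T s a t *
      M.runMeasure (π.toStrategy.shift ⟨s, a⟩) t (consRun ⟨s, a⟩ ⁻¹' B) ≠ ⊤ := fun a t =>
    ENNReal.mul_ne_top (ENNReal.mul_ne_top (PMF.apply_ne_top _ _) (PMF.apply_ne_top _ _))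
      (measure_ne_top _ _)
  rw [ENNReal.toReal_sum fun a _ => ENNReal.sum_ne_top.2 fun t _ => hfin a t]
  refine Finset.sum_congr rfl fun a _ => ?_
  rw [ENNReal.toReal_sum fun t _ => hfin a t, Finset.mul_sum]
  refine Finset.sum_congr rfl fun t _ => ?_
  rw [ENNReal.toReal_mul, ENNReal.toReal_mul, mul_assoc]
  rfl

/-- The potential of the distance to `G` bounds the expected time until `G` is visited, that is, the
sum over `k` of the probabilities that the first `k + 1` states avoid `G`. -/
theorem Positional.ae_exists_mem {M : MDP S Act} (π : M.Positional) {C G : Set S}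
    (hC : ∀ s ∈ C, ∀ t, π.Edge s t → t ∈ C)
    (hG : ∀ s ∈ C, ∃ g ∈ G, Relation.ReflTransGen π.Edge s g) (s : S) (hs : s ∈ C) :
    ∀ᵐ z ∂M.runMeasure π.toStrategy s, ∃ n, (z n).state ∈ G := by
  obtain ⟨p, hp, hp1, hpM⟩ := M.exists_minProb
  obtain ⟨d, hd, hdist⟩ := exists_distance π.Edge G
  -- The runs whose first `n` states avoid `G`; `q n t` is their probability from `t`.
  let avoid : ℕ → Set (ℕ → Step S Act) := fun n => {z | ∀ i < n, (z i).state ∉ G}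
  have hmeas : ∀ n, MeasurableSet (avoid n) := by
    intro n
    have : avoid n = ⋂ i ∈ Set.Iio n, {z | (z i).state ∉ G} := by ext z; simp [avoid]
    rw [this]
    exact MeasurableSet.biInter (Set.to_countable _) fun i _ =>
      measurableSet_step i fun x => x.state ∉ G
  let q : ℕ → S → ℝ := fun n t => (M.runMeasure π.toStrategy t).real (avoid n)
  have hq : ∀ n t, q (n + 1) t ≤ ∑ t', (M.T t (π.choose t) t').toReal * q n t' := by
    intro n t
    simp only [q]
    rw [π.runMeasure_real t (hmeas _)]
    refine Finset.sum_le_sum fun t' _ => mul_le_mul_of_nonneg_left ?_ ENNReal.toReal_nonneg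
    refine measureReal_mono fun z hz i hi => ?_
    exact hz (i + 1) (by omega)
  have hq0 : ∀ n t, t ∈ G → q (n + 1) t = 0 := by
    intro n t ht
    simp only [q]
    rw [π.runMeasure_real t (hmeas _)]
    refine Finset.sum_eq_zero fun t' _ => ?_
    have : consRun (Step.mk t (π.choose t)) ⁻¹' avoid (n + 1) = ∅ := by
      ext z
      simp only [Set.mem_preimage, Set.mem_empty_iff_false, iff_false]
      exact fun hz => hz 0 (by omega) ht
    rw [this]
    simp
  have hsum : ∀ n, ∀ t ∈ C, ∑ k ∈ Finset.range n, q (k + 1) t ≤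
      rankPotential p (Fintype.card S) (d t) := by
    intro n
    induction n with
    | zero => exact fun t _ => by simpa using rankPotential_nonneg hp hp1 _ _
    | succ n ih =>
      intro t ht
      by_cases hg : t ∈ G
      · rw [Finset.sum_eq_zero fun k _ => hq0 k t hg]
        exact rankPotential_nonneg hp hp1 _ _
      · obtain ⟨y, hy, hlt, -⟩ := hdist t hg (hG t ht)
        refine le_trans ?_ (one_add_sum_rankPotential_le hp hp1 (hd t) y hlt (hpM _ _ _ hy))
        rw [Finset.sum_range_succ', add_comm]
        refine add_le_add measureReal_le_one ?_
        refine (Finset.sum_le_sum fun k _ => hq (k + 1) t).trans ?_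
        rw [Finset.sum_comm]
        refine Finset.sum_le_sum fun t' _ => ?_
        rw [← Finset.mul_sum]
        by_cases h0 : M.T t (π.choose t) t' = 0
        · simp [h0]
        · exact mul_le_mul_of_nonneg_left (ih t' (hC t ht t' h0)) ENNReal.toReal_nonneg
  rw [ae_iff]
  set B := {z : ℕ → Step S Act | ¬ ∃ n, (z n).state ∈ G} with hB
  have hBq : ∀ n : ℕ, n * (M.runMeasure π.toStrategy s).real B ≤
      rankPotential p (Fintype.card S) (d s) := by
    intro n
    refine le_trans ?_ (hsum n s hs)
    rw [← nsmul_eq_mul, ← Finset.card_range n, ← Finset.sum_const, Finset.card_range]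
    refine Finset.sum_le_sum fun k _ => measureReal_mono fun z hz i _ hi => hz ⟨i, hi⟩
  have h0 : (M.runMeasure π.toStrategy s).real B ≤ 0 := by
    by_contra hcon
    rw [not_le] at hcon
    obtain ⟨n, hn⟩ := exists_nat_gt (rankPotential p (Fintype.card S) (d s) /
      (M.runMeasure π.toStrategy s).real B)
    rw [div_lt_iff₀ hcon] at hn
    exact absurd (hBq n) (not_le.2 hn)
  exact (measureReal_eq_zero_iff).1 (le_antisymm h0 measureReal_nonneg)

/-- If `G` can be reached from every state of a closed set of the Markov chain of `π`, it is almost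
surely visited infinitely often. -/
theorem Positional.ae_frequently_mem {M : MDP S Act} (π : M.Positional) {C G : Set S}
    (hC : ∀ s ∈ C, ∀ t, π.Edge s t → t ∈ C)
    (hG : ∀ s ∈ C, ∃ g ∈ G, Relation.ReflTransGen π.Edge s g) (s : S) (hs : s ∈ C) :
    ∀ᵐ z ∂M.runMeasure π.toStrategy s, ∃ᶠ n in atTop, (z n).state ∈ G := by
  have key : ∀ m, ∀ s ∈ C, ∀ᵐ z ∂M.runMeasure π.toStrategy s, ∃ n ≥ m, (z n).state ∈ G := by
    intro m
    induction m with
    | zero =>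
      intro s hs
      filter_upwards [π.ae_exists_mem hC hG s hs] with z ⟨n, hn⟩
      exact ⟨n, Nat.zero_le n, hn⟩
    | succ m ih =>
      intro s hs
      refine ae_runMeasure M _ s ?_ fun a t ha ht => ?_
      · have : {z : ℕ → Step S Act | ∃ n ≥ m + 1, (z n).state ∈ G} =
            ⋃ n ∈ Set.Ici (m + 1), {z | (z n).state ∈ G} := by ext z; simp
        rw [this]
        exact MeasurableSet.biUnion (Set.to_countable _) fun n _ =>
          measurableSet_step n fun x => x.state ∈ G
      · obtain rfl := π.toStrategy_ne_zero _ _ _ ha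
        filter_upwards [ih t (hC s hs t ht)] with w hw
        obtain ⟨n, hn, hw⟩ := hw
        exact ⟨n + 1, by omega, hw⟩
  have := ae_all_iff.2 fun m => key m s hs
  filter_upwards [this] with z hz
  exact frequently_atTop.2 hz

end MDP

/-! ### Improving a positional strategy by switching -/

namespace MDP

variable {S : Type u} {Act : Type v}

open Classical in
/-- Follow `σ` until the state `b` is visited, and `τ` from then on. -/
noncomputable def Strategy.switchAt {M : MDP S Act} (σ τ : M.Strategy) (b : S) : M.Strategy where
  choose h s := if s = b ∨ ∃ z ∈ h, z.state = b then τ.choose h s else σ.choose h s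
  support_subset h s := by
    split_ifs
    · exact τ.support_subset h s
    · exact σ.support_subset h s

theorem Positional.switchAt_shift_self {M : MDP S Act} (π τ : M.Positional) (b : S) (a : Act) :
    (π.toStrategy.switchAt τ.toStrategy b).shift ⟨b, a⟩ = τ.toStrategy := by
  simp only [Strategy.shift, Strategy.switchAt, Positional.toStrategy]
  congr 1
  funext h s
  rw [if_pos (Or.inr ⟨⟨b, a⟩, by simp, rfl⟩)]

theorem Positional.switchAt_shift_of_ne {M : MDP S Act} (π τ : M.Positional) {b s : S}
    (hs : s ≠ b) (a : Act) : (π.toStrategy.switchAt τ.toStrategy b).shift ⟨s, a⟩ =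
      π.toStrategy.switchAt τ.toStrategy b := by
  classical
  simp only [Strategy.shift, Strategy.switchAt, Positional.toStrategy]
  congr 1
  funext h t
  have : (t = b ∨ ∃ z ∈ Step.mk s a :: h, z.state = b) ↔ (t = b ∨ ∃ z ∈ h, z.state = b) := by
    simp [hs]
  exact if_congr this rfl rfl

variable [Fintype S] [Fintype Act]

theorem Positional.expReward_switchAt_self {M : MDP S Act} (π τ : M.Positional)
    (ρ : S → Act → S → ℝ) (b : S) (n : ℕ) :
    M.expReward ρ (π.toStrategy.switchAt τ.toStrategy b) n b = M.expReward ρ τ.toStrategy n b := by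
  cases n with
  | zero => simp only [expReward_zero]
  | succ n =>
    rw [MDP.expReward_succ, MDP.expReward_succ]
    have h1 : (π.toStrategy.switchAt τ.toStrategy b).choose [] b = τ.toStrategy.choose [] b :=
      if_pos (Or.inl rfl)
    simp only [h1, π.switchAt_shift_self τ b]
    rfl

theorem Positional.expReward_switchAt_succ {M : MDP S Act} (π τ : M.Positional)
    (ρ : S → Act → S → ℝ) {b s : S} (hs : s ≠ b) (n : ℕ) :
    M.expReward ρ (π.toStrategy.switchAt τ.toStrategy b) (n + 1) s =
      ∑ t, (M.T s (π.choose s) t).toReal * (ρ s (π.choose s) t +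
        M.expReward ρ (π.toStrategy.switchAt τ.toStrategy b) n t) := by
  rw [MDP.expReward_succ]
  have h1 : (π.toStrategy.switchAt τ.toStrategy b).choose [] s = π.toStrategy.choose [] s :=
    if_neg (by simp [hs])
  simp only [h1, π.switchAt_shift_of_ne τ hs]
  exact π.sum_toStrategy s fun a => ∑ t, (M.T s a t).toReal *
        (ρ s a t + M.expReward ρ (π.toStrategy.switchAt τ.toStrategy b) n t)

/-- The gain of the switching strategy is `p * (n * g - K)`, where `p` is the probability of a path
of `π` to `b`, up to a loss of at most `K`. -/
theorem Positional.exists_gain_switchAt {M : MDP S Act} (π τ : M.Positional)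
    (ρ : S → Act → S → ℝ) {b s : S} {g K : ℝ} (hg : 0 ≤ g) (hK : 0 ≤ K)
    (hb : ∀ n : ℕ, n * g - K ≤ M.expReward ρ τ.toStrategy n b - M.expReward ρ π.toStrategy n b)
    (hs : Relation.ReflTransGen π.Edge s b) :
    ∃ (m : ℕ) (q : ℝ), 0 < q ∧ ∀ n : ℕ, q * (n * g - K) - K ≤
      M.expReward ρ (π.toStrategy.switchAt τ.toStrategy b) (n + m) s -
        M.expReward ρ π.toStrategy (n + m) s := by
  classical
  set D : ℕ → S → ℝ := fun n t => M.expReward ρ (π.toStrategy.switchAt τ.toStrategy b) n t -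
        M.expReward ρ π.toStrategy n t with hD
  have hDb : ∀ n : ℕ, n * g - K ≤ D n b := fun n => by
    simp only [hD, π.expReward_switchAt_self τ]
    exact hb n
  have hDs : ∀ n t, t ≠ b → D (n + 1) t = ∑ t', (M.T t (π.choose t) t').toReal * D n t' := by
    intro n t ht
    simp only [hD, π.expReward_switchAt_succ τ ρ ht, π.expReward_succ]
    rw [← Finset.sum_sub_distrib]
    exact Finset.sum_congr rfl fun t' _ => by ring
  -- Before `b` is visited both strategies agree, and the visit costs at most `K`.
  have hlow : ∀ n t, -K ≤ D n t := by
    intro n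
    induction n with
    | zero => intro t; simp [hD, expReward_zero, hK]
    | succ n ih =>
      intro t
      by_cases ht : t = b
      · subst ht
        have h1 := hDb (n + 1)
        have h2 : (0 : ℝ) ≤ ((n + 1 : ℕ) : ℝ) * g := by positivity
        linarith
      · rw [hDs n t ht, ← one_mul (-K), ← PMF.sum_toReal (M.T t (π.choose t)), Finset.sum_mul]
        exact Finset.sum_le_sum fun t' _ => mul_le_mul_of_nonneg_left (ih t') ENNReal.toReal_nonneg
  change ∃ (m : ℕ) (q : ℝ), 0 < q ∧ ∀ n : ℕ, q * (n * g - K) - K ≤ D (n + m) s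
  clear_value D
  induction hs using Relation.ReflTransGen.head_induction_on with
  | refl => exact ⟨0, 1, one_pos, fun n => by rw [add_zero]; linarith [hDb n]⟩
  | @head x y hxy _ ih =>
    by_cases hx : x = b
    · subst hx
      exact ⟨0, 1, one_pos, fun n => by rw [add_zero]; linarith [hDb n]⟩
    obtain ⟨m, q, hq, hm⟩ := ih
    have hpos : 0 < (M.T x (π.choose x) y).toReal := ENNReal.toReal_pos hxy (PMF.apply_ne_top _ _)
    refine ⟨m + 1, (M.T x (π.choose x) y).toReal * q, mul_pos hpos hq, fun n => ?_⟩
    rw [← add_assoc, hDs _ _ hx]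
    have h1 : (M.T x (π.choose x) y).toReal * (D (n + m) y + K) ≤
        ∑ t', (M.T x (π.choose x) t').toReal * (D (n + m) t' + K) :=
      Finset.single_le_sum (f := fun t' => (M.T x (π.choose x) t').toReal * (D (n + m) t' + K))
        (fun t' _ => mul_nonneg ENNReal.toReal_nonneg (by linarith [hlow (n + m) t']))
        (Finset.mem_univ y)
    have h2 : ∑ t', (M.T x (π.choose x) t').toReal * (D (n + m) t' + K) =
        ∑ t', (M.T x (π.choose x) t').toReal * D (n + m) t' + K := by
      simp only [mul_add, Finset.sum_add_distrib]
      rw [← Finset.sum_mul, PMF.sum_toReal, one_mul]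
    have h3 := mul_le_mul_of_nonneg_left (hm n) hpos.le
    linarith

/-- A positional strategy that reaches a state from which its total reward stays bounded is not
optimal if another strategy collects a linearly growing reward from there. -/
theorem Positional.not_isAvgOptimalFrom {M : MDP S Act} (π τ : M.Positional)
    (ρ : S → Act → S → ℝ) {b s : S} {g K₁ K₂ : ℝ} (hg : 0 < g)
    (hτ : ∀ n : ℕ, n * g - K₁ ≤ M.expReward ρ τ.toStrategy n b)
    (hπ : ∀ n, M.expReward ρ π.toStrategy n b ≤ K₂)
    (hs : Relation.ReflTransGen π.Edge s b) : ¬ M.IsAvgOptimalFrom ρ π.toStrategy s := by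
  intro hopt
  have hopt := hopt (π.toStrategy.switchAt τ.toStrategy b)
  have hK : 0 ≤ K₁ + K₂ := by
    have h1 := hτ 0
    have h2 := hπ 0
    rw [expReward_zero] at h1 h2
    push_cast at h1
    linarith
  obtain ⟨m, q, hq, hm⟩ := π.exists_gain_switchAt τ ρ hg.le hK
    (fun n => by linarith [hτ n, hπ n]) hs
  set A : ℕ → ℝ := fun N => (1 / (N : ℝ)) * M.expReward ρ π.toStrategy N s with hA
  set B : ℕ → ℝ := fun N => (1 / (N : ℝ)) *
    M.expReward ρ (π.toStrategy.switchAt τ.toStrategy b) N s with hB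
  change limsup B atTop ≤ limsup A atTop at hopt
  obtain ⟨R, hR0, hR⟩ := exists_bound_reward ρ
  have hbound : ∀ (σ : M.Strategy) (N : ℕ), |(1 / (N : ℝ)) * M.expReward ρ σ N s| ≤ R := by
    intro σ N
    rw [abs_mul, abs_of_nonneg (by positivity)]
    rcases Nat.eq_zero_or_pos N with rfl | hN
    · simpa using hR0
    · have hN' : (0 : ℝ) < N := by exact_mod_cast hN
      rw [one_div, inv_mul_le_iff₀ hN']
      exact M.abs_expReward_le hR σ N s
  -- Asymptotically the gain per step is at least `q * g`; half of it absorbs the constant loss.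
  have hgap : ∀ᶠ N in atTop, A N + q * g / 2 ≤ B N := by
    obtain ⟨N₀, hN₀⟩ := exists_nat_gt (2 * (q * (m * g + (K₁ + K₂)) + (K₁ + K₂)) / (q * g))
    filter_upwards [eventually_ge_atTop N₀, eventually_ge_atTop m, eventually_gt_atTop 0]
      with N h1 h2 h3
    have hN' : (0 : ℝ) < N := by exact_mod_cast h3
    have h4 := hm (N - m)
    rw [Nat.sub_add_cancel h2, Nat.cast_sub h2] at h4
    have hN₁ : (N₀ : ℝ) ≤ N := by exact_mod_cast h1
    have h5 := hN₀.trans_le hN₁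
    rw [div_lt_iff₀ (mul_pos hq hg)] at h5
    have h6 : N * (q * g / 2) ≤ M.expReward ρ (π.toStrategy.switchAt τ.toStrategy b) N s -
        M.expReward ρ π.toStrategy N s := by linarith
    simp only [hA, hB]
    have h7 : q * g / 2 ≤ (1 / (N : ℝ)) *
        (M.expReward ρ (π.toStrategy.switchAt τ.toStrategy b) N s -
          M.expReward ρ π.toStrategy N s) := by
      rw [one_div, le_inv_mul_iff₀ hN']
      exact h6
    linarith
  have hAb : IsBoundedUnder (· ≥ ·) atTop A :=
    ⟨-R, eventually_map.2 (Eventually.of_forall fun N => (abs_le.1 (hbound _ N)).1)⟩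
  have hBb : IsBoundedUnder (· ≤ ·) atTop B :=
    ⟨R, eventually_map.2 (Eventually.of_forall fun N => (abs_le.1 (hbound _ N)).2)⟩
  have hδ : 0 < q * g / 4 := by positivity
  have h1 : ∀ᶠ N in atTop, B N < limsup B atTop + q * g / 4 :=
    eventually_lt_of_limsup_lt (by linarith) hBb
  have h2 : limsup A atTop ≤ limsup B atTop - q * g / 4 := by
    refine limsup_le_of_le hAb.isCoboundedUnder_le ?_
    filter_upwards [h1, hgap] with N h1 h2
    linarith
  linarith

end MDP

/-! ### Winning regions for the Büchi condition -/

namespace MDP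

variable {S : Type u} {Act : Type v}

/-- The action `a` is available in `s` and does not leave `Z`. -/
def Safe (M : MDP S Act) (Z : Set S) (s : S) (a : Act) : Prop :=
  a ∈ M.avail s ∧ ∀ t, M.T s a t ≠ 0 → t ∈ Z

/-- The states of `Z` from which safe actions lead, with positive probability, to a safe action
in `B`. -/
def trim (M : MDP S Act) (B : Set (Step S Act)) (Z : Set S) : Set S :=
  {s | s ∈ Z ∧ ∃ g ∈ {g | ∃ a, M.Safe Z g a ∧ ⟨g, a⟩ ∈ B},
    Relation.ReflTransGen (M.Edge (M.Safe Z)) s g}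

/-- `B` can be entered again and again from the set `Z`: the action `α` stays in `Z`, and it is in
`B` or decreases the rank `d` with positive probability. -/
structure IsWinningRegion (M : MDP S Act) (B : Set (Step S Act)) (Z : Set S) (α : S → Act)
    (d : S → ℕ) : Prop where
  safe : ∀ s ∈ Z, M.Safe Z s (α s)
  progress : ∀ s ∈ Z, ⟨s, α s⟩ ∈ B ∨ ∃ t, M.T s (α s) t ≠ 0 ∧ d t < d s

theorem exists_isWinningRegion_of_trim_eq [Fintype S] (M : MDP S Act) (B : Set (Step S Act))
    {Z : Set S} (hZ : M.trim B Z = Z) : ∃ (α : S → Act) (d : S → ℕ),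
      (∀ s, d s ≤ Fintype.card S) ∧ M.IsWinningRegion B Z α d := by
  obtain ⟨d, hd, hdist⟩ := exists_distance (M.Edge (M.Safe Z)) {g | ∃ a, M.Safe Z g a ∧ ⟨g, a⟩ ∈ B}
  have h1 : ∀ s, ∃ a, s ∈ Z → M.Safe Z s a ∧ (⟨s, a⟩ ∈ B ∨ ∃ t, M.T s a t ≠ 0 ∧ d t < d s) := by
    intro s
    obtain ⟨a₀, -⟩ := M.avail_nonempty s
    by_cases hs : s ∈ Z
    · rw [← hZ] at hs
      by_cases hg : s ∈ {g | ∃ a, M.Safe Z g a ∧ ⟨g, a⟩ ∈ B}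
      · obtain ⟨a, ha, hB⟩ := hg
        exact ⟨a, fun _ => ⟨ha, Or.inl hB⟩⟩
      · obtain ⟨t, ⟨a, ha, hat⟩, hlt, -⟩ := hdist s hg hs.2
        exact ⟨a, fun _ => ⟨ha, Or.inr ⟨t, hat, hlt⟩⟩⟩
    · exact ⟨a₀, fun h => absurd h hs⟩
  choose α hα using h1
  exact ⟨α, d, hd, fun s hs => (hα s hs).1, fun s hs => (hα s hs).2⟩

variable [Fintype S] [Fintype Act]

/-- If `B` is visited infinitely often with positive probability, a winning region can be reached.
Otherwise repeated trimming removes all reachable states; as a safe action leads from a state of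
rank `r` (the stage of its removal) to states of rank at most `r` and is not in `B`, whereas any
other action leads with positive probability to a state of smaller rank, the potential of the rank
bounds the expected number of visits of `B`. -/
theorem exists_isWinningRegion (M : MDP S Act) (B : Set (Step S Act)) (σ : M.Strategy) (s₀ : S)
    (h : M.runMeasure σ s₀ {z | ∃ᶠ n in atTop, z n ∈ B} ≠ 0) :
    ∃ (Z : Set S) (α : S → Act) (d : S → ℕ), (∀ s, d s ≤ Fintype.card S) ∧
      M.IsWinningRegion B Z α d ∧
      ∃ z ∈ Z, Relation.ReflTransGen (M.Edge fun s a => a ∈ M.avail s) s₀ z := by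
  let stage : ℕ → Set S := fun n => (M.trim B)^[n] Set.univ
  have hstage : ∀ n, stage (n + 1) = M.trim B (stage n) := fun n =>
    Function.iterate_succ_apply' _ _ _
  have hanti : Antitone stage := antitone_nat_of_succ_le fun n => by
    rw [hstage]
    exact fun s hs => hs.1
  obtain ⟨n, hn⟩ := WellFoundedGT.monotone_chain_condition
    (⟨fun n => OrderDual.toDual (stage n), fun _ _ h => hanti h⟩ : ℕ →o (Set S)ᵒᵈ)
  have hfix : M.trim B (stage n) = stage n := by
    rw [← hstage]
    exact (hn (n + 1) (Nat.le_succ n)).symm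
  obtain ⟨α, d, hd, hwin⟩ := M.exists_isWinningRegion_of_trim_eq B hfix
  by_cases hreach : ∃ z ∈ stage n, Relation.ReflTransGen (M.Edge fun s a => a ∈ M.avail s) s₀ z
  · exact ⟨stage n, α, d, hd, hwin, hreach⟩
  push Not at hreach
  exfalso
  refine h ?_
  set C : Set S := {s | Relation.ReflTransGen (M.Edge fun s a => a ∈ M.avail s) s₀ s} with hCdef
  have hC : ∀ s ∈ C, ∀ a, a ∈ M.avail s → ∀ t, M.T s a t ≠ 0 → t ∈ C :=
    fun s hs a ha t ht => Relation.ReflTransGen.tail hs ⟨a, ha, ht⟩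
  let rank : S → ℕ := fun s => sInf {i | s ∉ stage (i + 1)}
  have hne : ∀ s ∈ C, {i | s ∉ stage (i + 1)}.Nonempty := fun s hs =>
    ⟨n, fun hs' => hreach s (hanti (Nat.le_succ n) hs') hs⟩
  have hrank : ∀ s ∈ C, s ∉ stage (rank s + 1) := fun s hs => Nat.sInf_mem (hne s hs)
  have hrank_le : ∀ s i, s ∉ stage (i + 1) → rank s ≤ i := fun s i hs => Nat.sInf_le hs
  have hmem : ∀ s ∈ C, s ∈ stage (rank s) := by
    intro s hs
    rcases hk : rank s with _ | k
    · exact Set.mem_univ s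
    · by_contra hcon
      have := hrank_le s k hcon
      omega
  obtain ⟨p, hp, hp1, hpM⟩ := M.exists_minProb
  obtain ⟨d', hd', hmono⟩ := exists_bounded_rank rank
  have hs₀ : s₀ ∈ C := Relation.ReflTransGen.refl
  refine M.ae_not_frequently σ s₀ B (K := rankPotential p (Fintype.card S) (d' s₀)) fun k => ?_
  have := M.expReward_le (ρ := fun s a _ => B.indicator 1 ⟨s, a⟩) (Q := fun s a => a ∈ M.avail s) σ
    (fun h s a ha => σ.support_subset h s ha) (C := C)
    (h := fun s => rankPotential p (Fintype.card S) (d' s)) (g := 0) hC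
    (fun s _ => rankPotential_nonneg hp hp1 _ _) ?_ k s₀ hs₀
  · simpa using this
  intro s hs a ha
  simp only [mul_add, Finset.sum_add_distrib, zero_add]
  rw [← Finset.sum_mul, PMF.sum_toReal, one_mul]
  by_cases hsafe : M.Safe (stage (rank s)) s a
  · have hnot : (⟨s, a⟩ : Step S Act) ∉ B := by
      intro hB
      refine hrank s hs ?_
      rw [hstage]
      exact ⟨hmem s hs, s, ⟨a, hsafe, hB⟩, .refl⟩
    rw [Set.indicator_of_notMem hnot, zero_add]
    refine sum_rankPotential_le hp hp1 fun t ht => (hmono s t).2 (hrank_le t _ ?_)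
    intro htm
    rw [hstage] at htm
    obtain ⟨g, hg, hpath⟩ := htm.2
    refine hrank s hs ?_
    rw [hstage]
    exact ⟨hmem s hs, g, hg, hpath.head ⟨a, hsafe, ht⟩⟩
  · obtain ⟨t, ht, htm⟩ : ∃ t, M.T s a t ≠ 0 ∧ t ∉ stage (rank s) := by
      by_contra hcon
      push Not at hcon
      exact hsafe ⟨ha, hcon⟩
    have hlt : rank t < rank s := by
      rcases hk : rank s with _ | k
      · rw [hk] at htm
        exact absurd (Set.mem_univ t) htm
      · rw [hk] at htm
        exact Nat.lt_succ_of_le (hrank_le t k htm)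
    have h1 := one_add_sum_rankPotential_le hp hp1 (hd' s) t ((hmono s t).1 hlt) (hpM s a t ht)
    refine le_trans (add_le_add ?_ le_rfl) h1
    exact Set.indicator_apply_le' (fun _ => le_rfl) fun _ => zero_le_one

end MDP

namespace MDP

variable {S : Type u} {Act : Type v} [Fintype S] [Fintype Act]

/-- If a winning region can be reached from everywhere, and the reward is nonnegative in it and at
least `1` on the steps in `B`, the positional strategy that approaches the region, and then `B`,
collects a linearly growing reward. -/
theorem exists_positional_linear_reward (M : MDP S Act) (ρ : S → Act → S → ℝ)
    {B : Set (Step S Act)} {Z : Set S} {α : S → Act} {d : S → ℕ}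
    (hd : ∀ s, d s ≤ Fintype.card S) (hwin : M.IsWinningRegion B Z α d)
    (hρ : ∀ s ∈ Z, ∀ t, 0 ≤ ρ s (α s) t) (hρB : ∀ s ∈ Z, ⟨s, α s⟩ ∈ B → ∀ t, 1 ≤ ρ s (α s) t)
    (hreach : ∀ s, ∃ z ∈ Z, Relation.ReflTransGen (M.Edge fun s a => a ∈ M.avail s) s z) :
    ∃ (τ : M.Positional) (g K : ℝ), 0 < g ∧
      ∀ (n : ℕ) s, n * g - K ≤ M.expReward ρ τ.toStrategy n s := by
  classical
  obtain ⟨p, hp, hp1, hpM⟩ := M.exists_minProb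
  obtain ⟨e, he, hdist⟩ := exists_distance (M.Edge fun s a => a ∈ M.avail s) Z
  have h1 : ∀ s, ∃ a ∈ M.avail s, (s ∈ Z → a = α s) ∧
      (s ∉ Z → ∃ t, M.T s a t ≠ 0 ∧ e t < e s) := by
    intro s
    by_cases hs : s ∈ Z
    · exact ⟨α s, (hwin.safe s hs).1, fun _ => rfl, fun h => absurd hs h⟩
    · obtain ⟨t, ⟨a, ha, hat⟩, hlt, -⟩ := hdist s hs (hreach s)
      exact ⟨a, ha, fun h => absurd h hs, fun _ => ⟨t, hat, hlt⟩⟩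
  choose τ hτ hτZ hτe using h1
  obtain ⟨R, hR0, hR⟩ := exists_bound_reward ρ
  set N := Fintype.card S
  set H := stepBound p N
  have hH : 0 ≤ H := stepBound_nonneg hp N
  -- A reward of `1` on a step in `B` pays for `g` on this step and on the at most `H` steps (in
  -- expectation) until the next one.
  set g : ℝ := 1 / (1 + H) with hgdef
  have hg : 0 < g := by positivity
  have hgH : g + g * H = 1 := by
    rw [hgdef]
    field_simp
  -- `h₁` bounds the time until `Z` is reached, `h₂` the time until the next step in `B`.
  let h₁ : S → ℝ := fun s => if s ∈ Z then 0 else rankPotential p N (e s)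
  let h₂ : S → ℝ := fun s => if s ∈ Z then rankPotential p N (d s) else 0
  have h₁0 : ∀ s, 0 ≤ h₁ s := fun s => by
    simp only [h₁]; split_ifs; exacts [le_rfl, rankPotential_nonneg hp hp1 _ _]
  have h₂0 : ∀ s, 0 ≤ h₂ s := fun s => by
    simp only [h₂]; split_ifs; exacts [rankPotential_nonneg hp hp1 _ _, le_rfl]
  have h₁e : ∀ s, h₁ s ≤ rankPotential p N (e s) := fun s => by
    simp only [h₁]; split_ifs; exacts [rankPotential_nonneg hp hp1 _ _, le_rfl]
  have h₂H : ∀ s, h₂ s ≤ H := fun s => by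
    simp only [h₂]; split_ifs; exacts [rankPotential_le_stepBound hp _ _, hH]
  have hκ : 0 ≤ R + 1 := by linarith
  refine ⟨⟨τ, hτ⟩, g, g * H + (R + 1) * H, hg, fun n s => ?_⟩
  have key := M.le_expReward (ρ := ρ) (Q := fun s a => a = τ s)
    (Positional.toStrategy (M := M) ⟨τ, hτ⟩) (Positional.toStrategy_ne_zero _)
    (h := fun s => g * h₂ s + (R + 1) * h₁ s) (g := g)
    (fun s => add_nonneg (mul_nonneg hg.le (h₂0 s)) (mul_nonneg hκ (h₁0 s))) ?_ n s
  · have h3 := mul_le_mul_of_nonneg_left (h₂H s) hg.le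
    have h4 := mul_le_mul_of_nonneg_left
      ((h₁e s).trans (rankPotential_le_stepBound hp N (e s))) hκ
    linarith
  rintro s a rfl
  by_cases hs : s ∈ Z
  · have ha := hτZ s hs
    have hsafe := (hwin.safe s hs).2
    have hh₁ : h₁ s = 0 := if_pos hs
    have hh₂ : h₂ s = rankPotential p N (d s) := if_pos hs
    rw [ha, hh₁, mul_zero, add_zero]
    rcases hwin.progress s hs with hB | ⟨t₀, ht₀, hlt⟩
    · have h3 : ∑ t, (M.T s (α s) t).toReal * (1 - g * H) ≤ ∑ t, (M.T s (α s) t).toReal *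
          (ρ s (α s) t - (g * h₂ t + (R + 1) * h₁ t)) := by
        refine Finset.sum_le_sum fun t _ => ?_
        by_cases ht : M.T s (α s) t = 0
        · simp [ht]
        refine mul_le_mul_of_nonneg_left ?_ ENNReal.toReal_nonneg
        have h4 : h₁ t = 0 := if_pos (hsafe t ht)
        rw [h4]
        have h5 := mul_le_mul_of_nonneg_left (h₂H t) hg.le
        linarith [hρB s hs hB t]
      rw [← Finset.sum_mul, PMF.sum_toReal] at h3
      have h6 := mul_nonneg hg.le (h₂0 s)
      linarith
    · have h3 : ∑ t, (M.T s (α s) t).toReal * (-g * rankPotential p N (d t)) ≤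
          ∑ t, (M.T s (α s) t).toReal * (ρ s (α s) t - (g * h₂ t + (R + 1) * h₁ t)) := by
        refine Finset.sum_le_sum fun t _ => ?_
        by_cases ht : M.T s (α s) t = 0
        · simp [ht]
        refine mul_le_mul_of_nonneg_left ?_ ENNReal.toReal_nonneg
        have h4 : h₁ t = 0 := if_pos (hsafe t ht)
        have h5 : h₂ t = rankPotential p N (d t) := if_pos (hsafe t ht)
        rw [h4, h5]
        linarith [hρ s hs t]
      have h6 := one_add_sum_rankPotential_le hp hp1 (hd s) t₀ hlt (hpM _ _ _ ht₀)
      have h7 : ∑ t, (M.T s (α s) t).toReal * (-g * rankPotential p N (d t)) =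
          -g * ∑ t, (M.T s (α s) t).toReal * rankPotential p N (d t) := by
        rw [Finset.mul_sum]
        exact Finset.sum_congr rfl fun t _ => by ring
      rw [h7] at h3
      rw [hh₂]
      have h8 := mul_le_mul_of_nonneg_left h6 hg.le
      linarith
  · obtain ⟨t₀, ht₀, hlt⟩ := hτe s hs
    have hh₁ : h₁ s = rankPotential p N (e s) := if_neg hs
    have hh₂ : h₂ s = 0 := if_neg hs
    have h3 : ∑ t, ((M.T s (τ s) t).toReal * (-R - g * H) +
        -(R + 1) * ((M.T s (τ s) t).toReal * rankPotential p N (e t))) ≤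
        ∑ t, (M.T s (τ s) t).toReal * (ρ s (τ s) t - (g * h₂ t + (R + 1) * h₁ t)) := by
      refine Finset.sum_le_sum fun t _ => ?_
      have h5 := mul_le_mul_of_nonneg_left (h₂H t) hg.le
      have h6 := mul_le_mul_of_nonneg_left (h₁e t) hκ
      have h7 : (-R - g * H) + -(R + 1) * rankPotential p N (e t) ≤
          ρ s (τ s) t - (g * h₂ t + (R + 1) * h₁ t) := by
        linarith [abs_le.1 (hR s (τ s) t)]
      have h8 := mul_le_mul_of_nonneg_left h7 (ENNReal.toReal_nonneg (a := M.T s (τ s) t))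
      linarith
    rw [Finset.sum_add_distrib, ← Finset.sum_mul, PMF.sum_toReal, ← Finset.mul_sum] at h3
    have h6 := one_add_sum_rankPotential_le hp hp1 (he s) t₀ hlt (hpM _ _ _ ht₀)
    have h8 := mul_le_mul_of_nonneg_left h6 hκ
    rw [hh₁, hh₂]
    linarith

end MDP

/-! ### The induced finite-memory strategy -/

theorem PMF.sum_map_mul {α β : Type*} [Fintype α] [Fintype β] (μ : PMF α) (f : α → β)
    (F : β → ℝ≥0∞) : ∑ b, μ.map f b * F b = ∑ a, μ a * F (f a) := by
  classical
  simp only [PMF.map_apply, tsum_fintype, Finset.sum_mul]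
  rw [Finset.sum_comm]
  refine Finset.sum_congr rfl fun a _ => ?_
  simp

theorem PMF.sum_pure_mul {α : Type*} [Fintype α] (a : α) (F : α → ℝ≥0∞) :
    ∑ b, PMF.pure a b * F b = F a := by
  classical
  simp [PMF.pure_apply]

theorem MDP.runMeasure_apply_of_choose_eq_pure {S : Type u} {Act : Type v} [Fintype S] [Fintype Act]
    (M : MDP S Act) {σ : M.Strategy} {s : S} {a : Act} (h : σ.choose [] s = PMF.pure a)
    {B : Set (ℕ → Step S Act)} (hB : MeasurableSet B) :
    M.runMeasure σ s B = ∑ t, M.T s a t *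
      M.runMeasure (σ.shift ⟨s, a⟩) t (consRun ⟨s, a⟩ ⁻¹' B) := by
  rw [M.runMeasure_apply σ s hB]
  simp only [mul_assoc, ← Finset.mul_sum]
  rw [h, PMF.sum_pure_mul a fun a => ∑ t, M.T s a t *
      M.runMeasure (σ.shift ⟨s, a⟩) t (consRun ⟨s, a⟩ ⁻¹' B)]

/-- A function of a run that depends measurably on it once the value of `ν` is known is
measurable. -/
theorem measurable_of_countable_index {Ω β ι : Type*} [MeasurableSpace Ω]
    [MeasurableSpace β] [Countable ι] [MeasurableSpace ι] [DiscreteMeasurableSpace ι]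
    {ν : (ℕ → Ω) → ι} (hν : Measurable ν)
    {G : ι → (ℕ → Ω) → β} (hG : ∀ i, Measurable (G i)) : Measurable fun z => G (ν z) z :=
  (measurable_from_prod_countable_right (f := fun x : ι × (ℕ → Ω) => G x.1 x.2) hG).comp
    (hν.prodMk measurable_id)

theorem measurable_count {Ω : Type*} [MeasurableSpace Ω] [DiscreteMeasurableSpace Ω]
    (p : Ω → Prop) [DecidablePred p] (n : ℕ) :
    Measurable fun z : ℕ → Ω => Nat.count (fun i => p (z i)) n := by
  induction n with
  | zero => simp
  | succ n ih =>
    simp only [Nat.count_succ]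
    refine ih.add (Measurable.ite ?_ measurable_const measurable_const)
    exact measurable_pi_apply n (MeasurableSet.of_discrete (s := {x | p x}))

/-- As `Nat.nth` is `0` if there are too few indices, the value `0` is treated as the complement of
the others. -/
theorem measurable_nth {Ω : Type*} [MeasurableSpace Ω] [DiscreteMeasurableSpace Ω]
    (p : Ω → Prop) (k : ℕ) : Measurable fun z : ℕ → Ω => Nat.nth (fun i => p (z i)) k := by
  classical
  have hsucc : ∀ j, MeasurableSet {z : ℕ → Ω | Nat.nth (fun i => p (z i)) k = j + 1} := by
    intro j
    have : {z : ℕ → Ω | Nat.nth (fun i => p (z i)) k = j + 1} =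
        {z | p (z (j + 1))} ∩ {z | Nat.count (fun i => p (z i)) (j + 1) = k} := by
      ext z
      simp only [Set.mem_ofPred_eq, Set.mem_inter_iff]
      constructor
      · intro h
        have hk : ∀ hf : (Set.ofPred fun i => p (z i)).Finite, k < hf.toFinset.card := by
          intro hf
          by_contra hcon
          have := Nat.nth_of_card_le hf (not_lt.1 hcon)
          omega
        rw [← h]
        exact ⟨Nat.nth_mem k hk, Nat.count_nth hk⟩
      · rintro ⟨h1, h2⟩
        rw [← h2]
        exact Nat.nth_count (p := fun i => p (z i)) h1
    rw [this]
    exact (measurable_pi_apply (j + 1) (MeasurableSet.of_discrete (s := {x | p x}))).inter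
      (measurable_count p (j + 1) (measurableSet_singleton k))
  refine measurable_to_countable' fun j => ?_
  cases j with
  | zero =>
    have : (fun z : ℕ → Ω => Nat.nth (fun i => p (z i)) k) ⁻¹' {0} =
        (⋃ j, {z : ℕ → Ω | Nat.nth (fun i => p (z i)) k = j + 1})ᶜ := by
      ext z
      simp only [Set.mem_preimage, Set.mem_singleton_iff, Set.mem_compl_iff, Set.mem_iUnion,
        Set.mem_ofPred_eq, not_exists]
      constructor
      · intro h j
        omega
      · intro h
        by_contra hcon
        exact h _ (Nat.succ_pred_eq_of_ne_zero hcon).symm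
    rw [this]
    exact (MeasurableSet.iUnion hsucc).compl
  | succ j => exact hsucc j

namespace LabelledMDP

variable {S : Type u} {Act : Type v} {AP : Type w} {U : Type x}

/-- The successor of the memory state `m` that the induced strategy selects at the step `z`. -/
def memoryStep {M : LabelledMDP S Act AP} {R : RewardMachine (Set AP) U}
    (π : (M.prodReward R).Positional) (m : U) (z : Step S Act) : U :=
  match resolve π (z.state, m) with
  | some (_, u') => u'
  | none => R.init

/-- The induced strategy with the initial memory state `q`. A variable initial state is needed as
shifting the strategy by a step updates it. -/
noncomputable def inducedFrom {M : LabelledMDP S Act AP} {R : RewardMachine (Set AP) U}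
    (π : (M.prodReward R).Positional) (q : U) : M.Strategy where
  choose h s := match resolve π (s, h.foldl (memoryStep π) q) with
    | some (a, _) => PMF.pure a
    | none => PMF.pure (M.avail_nonempty s).some
  support_subset := by
    intro h s a ha
    split at ha
    · rename_i b u' hb
      rw [PMF.support_pure, Set.mem_singleton_iff] at ha
      subst ha
      unfold resolve at hb
      split at hb
      · rename_i m hm
        have h1 := π.mem_avail (s, h.foldl (memoryStep π) q)
        rw [hm, hb] at h1
        exact h1.1
      · have h1 := π.mem_avail (s, R.eps (h.foldl (memoryStep π) q))
        simp only at hb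
        rw [hb] at h1
        exact h1.1
    · rw [PMF.support_pure, Set.mem_singleton_iff] at ha
      exact ha ▸ (M.avail_nonempty s).some_mem

theorem inducedFrom_init {M : LabelledMDP S Act AP} {R : RewardMachine (Set AP) U}
    (π : (M.prodReward R).Positional) : inducedFrom π R.init = induced π := rfl

theorem inducedFrom_shift {M : LabelledMDP S Act AP} {R : RewardMachine (Set AP) U}
    (π : (M.prodReward R).Positional) (q : U) (z : Step S Act) :
    (inducedFrom π q).shift z = inducedFrom π (memoryStep π q z) := rfl

/-- The `n`-th step of the run of the product, from the machine state `q`, that follows `π` and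
whose moves in `M` are those of the run `z`. -/
def unfoldRun {M : LabelledMDP S Act AP} {R : RewardMachine (Set AP) U}
    (π : (M.prodReward R).Positional) :
    ℕ → U → (ℕ → Step S Act) → Step (S × U) (Option (Act × U))
  | 0, q, z => ⟨((z 0).state, q), match π.choose ((z 0).state, q) with
    | some (_, q') => some ((z 0).action, q')
    | none => none⟩
  | n + 1, q, z => match π.choose ((z 0).state, q) with
    | some (_, q') => unfoldRun π n q' fun i => z (i + 1)
    | none => unfoldRun π n (R.eps q) z

/-- The move of `M` that a step of the product makes (for an `ε`-step, an arbitrary one). -/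
noncomputable def moveOf (M : LabelledMDP S Act AP) (z : Step (S × U) (Option (Act × U))) :
    Step S Act :=
  ⟨z.state.1, match z.action with
    | some (a, _) => a
    | none => (M.avail_nonempty z.state.1).some⟩

section unfoldRun

variable {M : LabelledMDP S Act AP} {R : RewardMachine (Set AP) U}
  (π : (M.prodReward R).Positional) {q q' : U} {z : ℕ → Step S Act} {a : Act}

theorem unfoldRun_zero_of_none (h : π.choose ((z 0).state, q) = none) :
    unfoldRun π 0 q z = ⟨((z 0).state, q), none⟩ := by
  simp only [unfoldRun, h]

theorem unfoldRun_zero_of_some (h : π.choose ((z 0).state, q) = some (a, q')) :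
    unfoldRun π 0 q z = ⟨((z 0).state, q), some ((z 0).action, q')⟩ := by
  simp only [unfoldRun, h]

theorem unfoldRun_succ_of_none (h : π.choose ((z 0).state, q) = none) (n : ℕ) :
    unfoldRun π (n + 1) q z = unfoldRun π n (R.eps q) z := by
  conv_lhs => unfold unfoldRun
  rw [h]

theorem unfoldRun_succ_of_some (h : π.choose ((z 0).state, q) = some (a, q')) (n : ℕ) :
    unfoldRun π (n + 1) q z = unfoldRun π n q' fun i => z (i + 1) := by
  conv_lhs => unfold unfoldRun
  rw [h]

open Classical in
/-- Deleting the `ε`-steps of the unfolding of `z` gives back `z`. -/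
theorem moveOf_unfoldRun (n : ℕ) (q : U) (z : ℕ → Step S Act)
    (h : (unfoldRun π n q z).action ≠ none) :
    M.moveOf (unfoldRun π n q z) =
      z (Nat.count (fun i => (unfoldRun π i q z).action ≠ none) n) := by
  induction n generalizing q z with
  | zero =>
    rw [Nat.count_zero]
    rcases hc : π.choose ((z 0).state, q) with _ | ⟨a, q'⟩
    · simp [unfoldRun_zero_of_none π hc] at h
    · rw [unfoldRun_zero_of_some π hc]
      rfl
  | succ n ih =>
    rw [Nat.count_succ']
    rcases hc : π.choose ((z 0).state, q) with _ | ⟨a, q'⟩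
    · simp only [unfoldRun_succ_of_none π hc, unfoldRun_zero_of_none π hc] at h ⊢
      exact ih _ _ h
    · simp only [unfoldRun_succ_of_some π hc, unfoldRun_zero_of_some π hc] at h ⊢
      exact ih _ _ h

end unfoldRun

variable [Fintype S] [Fintype Act]

theorem measurable_unfoldRun {M : LabelledMDP S Act AP} {R : RewardMachine (Set AP) U}
    (π : (M.prodReward R).Positional) (n : ℕ) (q : U) : Measurable (unfoldRun π n q) := by
  induction n generalizing q with
  | zero =>
    exact (Measurable.of_discrete (f := fun z : Step S Act =>
      (⟨(z.state, q), match π.choose (z.state, q) with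
        | some (_, q') => some (z.action, q')
        | none => none⟩ : Step (S × U) (Option (Act × U))))).comp (measurable_pi_apply 0)
  | succ n ih =>
    refine measurable_of_countable_index (measurable_pi_apply 0) (G := fun (y : Step S Act) z =>
      match π.choose (y.state, q) with
      | some (_, q') => unfoldRun π n q' fun i => z (i + 1)
      | none => unfoldRun π n (R.eps q) z) fun y => ?_
    rcases π.choose (y.state, q) with _ | ⟨a, q'⟩
    · exact ih _
    · exact (ih q').comp (by fun_prop)

/-- After an `ε`-step, the memory states before and after it select the same move and the same next
memory state in the current state of `M`, so that the strategies agree from there. -/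
theorem runMeasure_inducedFrom_eps {M : LabelledMDP S Act AP} {R : RewardMachine (Set AP) U}
    (hR : ∀ u, R.eps u = R.init) (π : (M.prodReward R).Positional) {s : S} {q : U}
    (h : π.choose (s, q) = none) :
    M.runMeasure (inducedFrom π q) s = M.runMeasure (inducedFrom π (R.eps q)) s := by
  have h1 : resolve π (s, q) = resolve π (s, R.eps q) := by
    rcases hc : π.choose (s, R.eps q) with _ | m
    · simp only [resolve, h, hc]
      rw [hR (R.eps q), ← hR q, hc]
    · simp only [resolve, h, hc]
  have h2 : (inducedFrom π q).choose [] s = (inducedFrom π (R.eps q)).choose [] s := by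
    simp only [inducedFrom, List.foldl_nil, h1]
  have h3 : ∀ a, memoryStep π q ⟨s, a⟩ = memoryStep π (R.eps q) ⟨s, a⟩ := fun a => by
    simp only [memoryStep, h1]
  rw [MDP.runMeasure_eq_sum, MDP.runMeasure_eq_sum M.toMDP (inducedFrom π (R.eps q))]
  simp only [h2, inducedFrom_shift, h3]

/-- Unfolding maps the law of the runs of `M` under the induced strategy to the law of the runs of
the product under `π`. -/
theorem map_unfoldRun [Fintype U] {M : LabelledMDP S Act AP} {R : RewardMachine (Set AP) U}
    (hR : ∀ u, R.eps u = R.init) (π : (M.prodReward R).Positional) (s : S) (q : U) :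
    (M.runMeasure (inducedFrom π q) s).map (fun z n => unfoldRun π n q z) =
      (M.prodReward R).runMeasure π.toStrategy (s, q) := by
  have hmeas : ∀ q, Measurable fun (z : ℕ → Step S Act) n => unfoldRun π n q z := fun q =>
    measurable_pi_lambda _ fun n => measurable_unfoldRun π n q
  have : IsProbabilityMeasure ((M.runMeasure (inducedFrom π q) s).map
      (fun z n => unfoldRun π n q z)) := Measure.isProbabilityMeasure_map (hmeas q).aemeasurable
  refine Measure.ext_of_cylinder fun n y => ?_
  rw [Measure.map_apply (hmeas q) (measurableSet_cylinder n y)]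
  clear this
  induction n generalizing s q y with
  | zero => simp
  | succ n ih =>
    have hpure : π.toStrategy.choose [] (s, q) = PMF.pure (π.choose (s, q)) := rfl
    rw [MDP.runMeasure_apply_of_choose_eq_pure _ hpure (measurableSet_cylinder _ _)]
    have hcons : ∀ x : Step (S × U) (Option (Act × U)), consRun x ⁻¹' {z | ∀ i < n + 1, z i = y i} =
        {z | x = y 0 ∧ ∀ i < n, z i = y (i + 1)} := by
      intro x
      ext z
      simp only [Set.mem_preimage, Set.mem_ofPred_eq]
      rw [Nat.forall_lt_succ_left']
      simp
    rw [hcons]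
    change _ = ∑ t, _ * (M.prodReward R).runMeasure π.toStrategy t _
    rcases hc : π.choose (s, q) with _ | ⟨a, q'⟩
    · have hT : (M.prodReward R).T (s, q) none = PMF.pure (s, R.eps q) := rfl
      rw [hT, PMF.sum_pure_mul (s, R.eps q) fun t => (M.prodReward R).runMeasure π.toStrategy t
        {z | ⟨(s, q), none⟩ = y 0 ∧ ∀ i < n, z i = y (i + 1)}]
      have hae : ((fun (z : ℕ → Step S Act) n => unfoldRun π n q z) ⁻¹'
          {z | ∀ i < n + 1, z i = y i} : Set _) =ᵐ[M.runMeasure (inducedFrom π q) s]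
          {z | ⟨(s, q), none⟩ = y 0 ∧ ∀ i < n, unfoldRun π i (R.eps q) z = y (i + 1)} := by
        filter_upwards [MDP.ae_state_zero M.toMDP (inducedFrom π q) s] with z hz
        refine propext ?_
        change (∀ i < n + 1, unfoldRun π i q z = y i) ↔ (_ ∧ _)
        rw [Nat.forall_lt_succ_left']
        have hc' : π.choose ((z 0).state, q) = none := by rw [hz, hc]
        simp only [unfoldRun_zero_of_none π hc', unfoldRun_succ_of_none π hc', hz]
      rw [measure_congr hae, runMeasure_inducedFrom_eps hR π hc]
      by_cases hy : (⟨(s, q), none⟩ : Step (S × U) (Option (Act × U))) = y 0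
      · simp only [hy, true_and]
        exact ih s (R.eps q) fun i => y (i + 1)
      · simp [hy]
    · have hT : (M.prodReward R).T (s, q) (some (a, q')) = (M.T s a).map fun s' => (s', q') := rfl
      rw [hT, PMF.sum_map_mul (M.T s a) (fun s' => (s', q')) fun t =>
        (M.prodReward R).runMeasure π.toStrategy t
          {z | ⟨(s, q), some (a, q')⟩ = y 0 ∧ ∀ i < n, z i = y (i + 1)}]
      have hres : resolve π (s, q) = some (a, q') := by simp only [resolve, hc]
      have hpure' : (inducedFrom π q).choose [] s = PMF.pure a := by
        simp only [inducedFrom, List.foldl_nil, hres]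
      have hmem : memoryStep π q ⟨s, a⟩ = q' := by simp only [memoryStep, hres]
      rw [MDP.runMeasure_apply_of_choose_eq_pure _ hpure'
        (hmeas q (measurableSet_cylinder _ _)), inducedFrom_shift, hmem]
      refine Finset.sum_congr rfl fun s' _ => ?_
      congr 1
      have hset : consRun (Step.mk s a) ⁻¹' ((fun (z : ℕ → Step S Act) n => unfoldRun π n q z) ⁻¹'
          {z | ∀ i < n + 1, z i = y i}) =
          {z | ⟨(s, q), some (a, q')⟩ = y 0 ∧ ∀ i < n, unfoldRun π i q' z = y (i + 1)} := by
        ext z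
        change (∀ i < n + 1, unfoldRun π i q (consRun ⟨s, a⟩ z) = y i) ↔ (_ ∧ _)
        rw [Nat.forall_lt_succ_left']
        have hc' : π.choose ((consRun (Step.mk s a) z 0).state, q) = some (a, q') := hc
        simp only [unfoldRun_zero_of_some π hc', unfoldRun_succ_of_some π hc', consRun_zero,
          consRun_succ]
      rw [hset]
      by_cases hy : (⟨(s, q), some (a, q')⟩ : Step (S × U) (Option (Act × U))) = y 0
      · simp only [hy, true_and]
        exact ih s' q' fun i => y (i + 1)
      · simp [hy]

/-- The induced strategy satisfies a language with at least the probability with which the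
positional strategy of the product does. -/
theorem runMeasure_prodSatisfies_le [Fintype U] {M : LabelledMDP S Act AP}
    {R : RewardMachine (Set AP) U}
    (hR : ∀ u, R.eps u = R.init) (π : (M.prodReward R).Positional) (L : Set (ℕ → Set AP)) (s : S) :
    (M.prodReward R).runMeasure π.toStrategy (s, R.init) (M.prodSatisfies L) ≤
      M.runMeasure (induced π) s {z | (fun n => M.label (z n).state) ∈ L} := by
  classical
  set μ := M.runMeasure (induced π) s
  -- The language need not be known to be measurable.
  set B := toMeasurable μ {z | (fun n => M.label (z n).state) ∈ L}
  let moves : (ℕ → Step (S × U) (Option (Act × U))) → ℕ → Step S Act := fun z k =>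
    M.moveOf (z (Nat.nth (fun n => (z n).action ≠ none) k))
  have hmoves : Measurable moves := measurable_pi_lambda _ fun k =>
    measurable_of_countable_index (measurable_nth (fun x => x.action ≠ none) k)
      (G := fun n z => M.moveOf (z n)) fun n =>
        (Measurable.of_discrete (f := M.moveOf)).comp (measurable_pi_apply n)
  have hinf : MeasurableSet {z : ℕ → Step (S × U) (Option (Act × U)) |
      {n | (z n).action ≠ none}.Infinite} := by
    have : {z : ℕ → Step (S × U) (Option (Act × U)) | {n | (z n).action ≠ none}.Infinite} =
        ⋂ m, ⋃ n ∈ Set.Ici m, {z | (z n).action ≠ none} := by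
      ext z
      simp only [Set.mem_ofPred_eq, Set.mem_iInter, Set.mem_iUnion, Set.mem_Ici, exists_prop]
      rw [← Nat.frequently_atTop_iff_infinite, frequently_atTop]
    rw [this]
    exact MeasurableSet.iInter fun m => MeasurableSet.biUnion (Set.to_countable _) fun n _ =>
      MDP.measurableSet_step n fun x => x.action ≠ none
  have hsub : M.prodSatisfies L ⊆
      {z | {n | (z n).action ≠ none}.Infinite} ∩ moves ⁻¹' B :=
    fun z hz => ⟨hz.1, subset_toMeasurable μ _ hz.2⟩
  have hmeas : Measurable fun (z : ℕ → Step S Act) n => unfoldRun π n R.init z :=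
    measurable_pi_lambda _ fun n => measurable_unfoldRun π n R.init
  calc (M.prodReward R).runMeasure π.toStrategy (s, R.init) (M.prodSatisfies L)
      ≤ (M.prodReward R).runMeasure π.toStrategy (s, R.init)
        ({z | {n | (z n).action ≠ none}.Infinite} ∩ moves ⁻¹' B) := measure_mono hsub
    _ = μ ((fun z n => unfoldRun π n R.init z) ⁻¹'
        ({z | {n | (z n).action ≠ none}.Infinite} ∩ moves ⁻¹' B)) := by
      rw [← map_unfoldRun hR π s R.init, Measure.map_apply hmeas
        (hinf.inter (hmoves (measurableSet_toMeasurable _ _))), inducedFrom_init]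
    _ ≤ μ B := by
      refine measure_mono fun z hz => ?_
      have hz1 : {n | (unfoldRun π n R.init z).action ≠ none}.Infinite := hz.1
      have hz2 : moves (fun n => unfoldRun π n R.init z) ∈ B := hz.2
      have : moves (fun n => unfoldRun π n R.init z) = z := by
        funext k
        simp only [moves]
        rw [moveOf_unfoldRun π _ _ _ (Nat.nth_mem_of_infinite hz1 k),
          Nat.count_nth_of_infinite hz1]
      rwa [this] at hz2
    _ = μ {z | (fun n => M.label (z n).state) ∈ L} := measure_toMeasurable _

end LabelledMDP

/-! ### Absolute liveness languages -/

/-- Prefixing an accepted word with `b` shows that `b` can be read in the initial state. -/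
theorem BuchiAutomaton.nonempty_of_isAbsoluteLiveness {α : Type w} {Q : Type x}
    {A : BuchiAutomaton α Q} (hA : IsAbsoluteLiveness A.language) (b : α) :
    (A.δ A.init b).Nonempty := by
  obtain ⟨w, hw⟩ := hA.1
  obtain ⟨r, h0, hr, -⟩ := hA.2 [b] w hw
  have h1 := hr 0
  rw [h0] at h1
  exact ⟨_, h1⟩

theorem IsAbsoluteLiveness.of_tail {α : Type w} {L : Set (ℕ → α)} (hL : IsAbsoluteLiveness L)
    {w : ℕ → α} (k : ℕ) (h : (fun i => w (k + i)) ∈ L) : w ∈ L := by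
  convert hL.2 (List.ofFn fun i : Fin k => w i) _ h using 1
  funext n
  unfold prependWord
  split_ifs with hn
  · simp
  · rw [List.length_ofFn] at hn ⊢
    beta_reduce
    rw [Nat.add_sub_cancel' (not_lt.1 hn)]

namespace LabelledMDP

variable {S : Type u} {Act : Type v} {AP : Type w} {Q : Type x}

/-! ### Winning regions in the product with the reward machine -/

theorem prodReward_edge_eps (M : LabelledMDP S Act AP) (A : BuchiAutomaton (Set AP) Q) (c : ℝ)
    (s : S) (q : Q) : (M.prodReward (A.rewardMachine c)).Edge
      (fun x a => a ∈ (M.prodReward (A.rewardMachine c)).avail x) (s, q) (s, A.init) := by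
  refine ⟨none, trivial, ?_⟩
  change PMF.pure (s, A.init) (s, A.init) ≠ 0
  simp

theorem map_prodMk_ne_zero {μ : PMF S} {s : S} (q : Q) (h : μ s ≠ 0) :
    μ.map (fun s' => (s', q)) (s, q) ≠ 0 := by
  rw [← PMF.mem_support_iff] at h ⊢
  rw [PMF.support_map]
  exact ⟨s, h, rfl⟩

theorem prodAutomaton_reflTransGen (M : LabelledMDP S Act AP) (A : BuchiAutomaton (Set AP) Q)
    (c : ℝ) {y z : S × Q} (h : Relation.ReflTransGen
      ((M.prodAutomaton A).Edge fun x a => a ∈ (M.prodAutomaton A).avail x) y z) :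
    Relation.ReflTransGen ((M.prodReward (A.rewardMachine c)).Edge
      fun x a => a ∈ (M.prodReward (A.rewardMachine c)).avail x) y z := by
  induction h with
  | refl => exact .refl
  | tail _ hbc ih =>
    obtain ⟨β, hβ, hT⟩ := hbc
    cases β with
    | none =>
      have h1 : PMF.pure _ _ ≠ 0 := hT
      rw [← PMF.mem_support_iff, PMF.support_pure, Set.mem_singleton_iff] at h1
      exact h1 ▸ ih
    | some m => exact ih.tail ⟨some m, hβ, hT⟩

/-- A move of `M` is followed by a reset, so that every move starts in the initial state of the
automaton, where it is never blocked. -/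
theorem prodReward_reflTransGen [Fintype S] [Fintype Act] (M : LabelledMDP S Act AP)
    (A : BuchiAutomaton (Set AP) Q) (c : ℝ) (hM : M.IsCommunicating)
    (hA : IsAbsoluteLiveness A.language) (s s' : S) (q : Q) :
    Relation.ReflTransGen ((M.prodReward (A.rewardMachine c)).Edge
      fun x a => a ∈ (M.prodReward (A.rewardMachine c)).avail x) (s, q) (s', A.init) := by
  induction hM.reflTransGen s s' with
  | refl => exact .single (M.prodReward_edge_eps A c s q)
  | @tail t t' _ hbc ih =>
    obtain ⟨a, ha, hT⟩ := hbc
    obtain ⟨q', hq'⟩ := A.nonempty_of_isAbsoluteLiveness hA (M.label t)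
    have h1 : (M.prodReward (A.rewardMachine c)).Edge
        (fun x a => a ∈ (M.prodReward (A.rewardMachine c)).avail x) (t, A.init) (t', q') :=
      ⟨some (a, q'), ⟨ha, hq'⟩, map_prodMk_ne_zero q' hT⟩
    exact (ih.tail h1).tail (M.prodReward_edge_eps A c t' q')

theorem prodRho_some_nonneg (M : LabelledMDP S Act AP) (A : BuchiAutomaton (Set AP) Q) (c : ℝ)
    (x y : S × Q) (m : Act × Q) : 0 ≤ M.prodRho (A.rewardMachine c) x (some m) y := by
  simp only [prodRho, BuchiAutomaton.rewardMachine]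
  split_ifs <;> norm_num

theorem prodRho_some_le_one (M : LabelledMDP S Act AP) (A : BuchiAutomaton (Set AP) Q) (c : ℝ)
    (x y : S × Q) (m : Act × Q) : M.prodRho (A.rewardMachine c) x (some m) y ≤ 1 := by
  simp only [prodRho, BuchiAutomaton.rewardMachine]
  split_ifs <;> norm_num

theorem prodRho_eq_one (M : LabelledMDP S Act AP) (A : BuchiAutomaton (Set AP) Q) (c : ℝ)
    {x y : S × Q} {β : Option (Act × Q)} (h : ⟨x, β⟩ ∈ M.prodAcc A) :
    M.prodRho (A.rewardMachine c) x β y = 1 := by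
  cases β with
  | none => exact h.elim
  | some m => exact if_pos h

theorem prodRho_nonpos (M : LabelledMDP S Act AP) (A : BuchiAutomaton (Set AP) Q) {c : ℝ}
    (hc : c ≤ 0) {x y : S × Q} {β : Option (Act × Q)} (h : ⟨x, β⟩ ∉ M.prodAcc A) :
    M.prodRho (A.rewardMachine c) x β y ≤ 0 := by
  cases β with
  | none => exact hc
  | some m => exact (if_neg h).le

/-- In a winning region of `M × A` no action halts the run, so that it is a winning region of the
product with the reward machine. -/
theorem isWinningRegion_prodReward (M : LabelledMDP S Act AP) (A : BuchiAutomaton (Set AP) Q)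
    (c : ℝ) {Z : Set (S × Q)} {α : S × Q → Option (Act × Q)} {d : S × Q → ℕ}
    (h : (M.prodAutomaton A).IsWinningRegion (M.prodAcc A) Z α d) :
    (∀ x ∈ Z, α x ≠ none) ∧
      (M.prodReward (A.rewardMachine c)).IsWinningRegion (M.prodAcc A) Z α d := by
  have hne : ∀ x ∈ Z, α x ≠ none := by
    intro x hx hnone
    rcases h.progress x hx with hB | ⟨t, ht, hlt⟩
    · rw [hnone] at hB
      exact hB.elim
    · rw [hnone] at ht
      have h1 : PMF.pure x t ≠ 0 := ht
      rw [← PMF.mem_support_iff, PMF.support_pure, Set.mem_singleton_iff] at h1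
      rw [h1] at hlt
      exact lt_irrefl _ hlt
  refine ⟨hne, fun x hx => ?_, fun x hx => ?_⟩
  · obtain ⟨m, hm⟩ := Option.ne_none_iff_exists'.1 (hne x hx)
    have h1 := h.safe x hx
    rw [hm] at h1 ⊢
    exact h1
  · obtain ⟨m, hm⟩ := Option.ne_none_iff_exists'.1 (hne x hx)
    have h1 := h.progress x hx
    rw [hm] at h1 ⊢
    exact h1

/-- If the automaton can be satisfied in `M × A` with positive probability, a positional strategy of
the product with the reward machine collects a linearly growing reward: it returns to a winning
region by resets and moves of the communicating MDP. -/
theorem exists_linear_reward [Fintype S] [Fintype Act] [Fintype Q] (M : LabelledMDP S Act AP)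
    (A : BuchiAutomaton (Set AP) Q) (c : ℝ) (hM : M.IsCommunicating)
    (hA : IsAbsoluteLiveness A.language) (s : S) (h : M.optSynSat A s ≠ 0) :
    ∃ (τ : (M.prodReward (A.rewardMachine c)).Positional) (g K : ℝ), 0 < g ∧ ∀ (n : ℕ) x,
      n * g - K ≤ (M.prodReward (A.rewardMachine c)).expReward (M.prodRho (A.rewardMachine c))
        τ.toStrategy n x := by
  obtain ⟨σ, hσ⟩ : ∃ σ : (M.prodAutomaton A).Strategy, (M.prodAutomaton A).runMeasure σ (s, A.init)
      {z | ∃ᶠ n in atTop, z n ∈ M.prodAcc A} ≠ 0 := by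
    by_contra hcon
    push Not at hcon
    exact h (by rw [optSynSat, ENNReal.iSup_eq_zero.2 hcon])
  obtain ⟨Z, α, d, hd, hwin, z, hz, hreach⟩ := MDP.exists_isWinningRegion _ _ σ _ hσ
  obtain ⟨hne, hwin'⟩ := M.isWinningRegion_prodReward A c hwin
  refine MDP.exists_positional_linear_reward _ _ hd hwin' ?_ ?_ ?_
  · intro x hx y
    obtain ⟨m, hm⟩ := Option.ne_none_iff_exists'.1 (hne x hx)
    rw [hm]
    exact M.prodRho_some_nonneg A c x y m
  · exact fun x _ hB y => (M.prodRho_eq_one A c hB).ge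
  · rintro ⟨s', q⟩
    exact ⟨z, hz, (M.prodReward_reflTransGen A c hM hA s' s q).trans
      (M.prodAutomaton_reflTransGen A c hreach)⟩

/-! ### States of bounded total reward -/

section bounded

variable [Fintype S] [Fintype Act] [Fintype Q] {M : LabelledMDP S Act AP}
  {A : BuchiAutomaton (Set AP) Q} {c : ℝ} (π : (M.prodReward (A.rewardMachine c)).Positional)

/-- If resets remain possible forever and `-c` exceeds the expected number of steps until the next
reset, the total reward is bounded. -/
theorem exists_expReward_le_of_reset {p : ℝ} (hp : 0 < p) (hp1 : p ≤ 1)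
    (hpM : ∀ x β y, (M.prodReward (A.rewardMachine c)).T x β y ≠ 0 →
      p ≤ ((M.prodReward (A.rewardMachine c)).T x β y).toReal)
    (hc : c ≤ -stepBound p (Fintype.card (S × Q))) (x : S × Q)
    (hx : ∀ y, Relation.ReflTransGen π.Edge x y →
      ∃ z ∈ {z | π.choose z = none}, Relation.ReflTransGen π.Edge y z) :
    ∃ K, ∀ n, (M.prodReward (A.rewardMachine c)).expReward (M.prodRho (A.rewardMachine c))
      π.toStrategy n x ≤ K := by
  obtain ⟨d, hd, hdist⟩ := exists_distance π.Edge {z | π.choose z = none}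
  refine ⟨rankPotential p (Fintype.card (S × Q)) (d x), fun n => ?_⟩
  have key := (M.prodReward (A.rewardMachine c)).expReward_le
    (ρ := M.prodRho (A.rewardMachine c)) (Q := fun y a => a = π.choose y) π.toStrategy
    π.toStrategy_ne_zero (C := {y | Relation.ReflTransGen π.Edge x y})
    (h := fun y => rankPotential p (Fintype.card (S × Q)) (d y)) (g := 0) ?_
    (fun y _ => rankPotential_nonneg hp hp1 _ _) ?_ n x Relation.ReflTransGen.refl
  · simpa using key
  · rintro y hy a rfl t ht
    exact Relation.ReflTransGen.tail hy ht
  · rintro y hy a rfl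
    rw [zero_add]
    rcases hβ : π.choose y with _ | m
    · refine le_trans ?_ (rankPotential_nonneg hp hp1 _ _)
      refine Finset.sum_nonpos fun t _ => mul_nonpos_of_nonneg_of_nonpos ENNReal.toReal_nonneg ?_
      have h1 : M.prodRho (A.rewardMachine c) y none t = c := rfl
      rw [h1]
      linarith [rankPotential_le_stepBound hp (Fintype.card (S × Q)) (d t)]
    · have hnone : y ∉ {z | π.choose z = none} := fun h => by
        rw [Set.mem_ofPred_eq, hβ] at h
        cases h
      obtain ⟨t, ht, hlt, -⟩ := hdist y hnone (hx y hy)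
      have h1 := one_add_sum_rankPotential_le hp hp1 (hd y) t hlt (hpM _ _ _ ht)
      refine le_trans ?_ h1
      rw [hβ, ← PMF.sum_toReal ((M.prodReward (A.rewardMachine c)).T y (some m)),
        ← Finset.sum_add_distrib]
      refine Finset.sum_le_sum fun t _ => ?_
      rw [mul_add]
      refine add_le_add ?_ le_rfl
      exact mul_le_of_le_one_right ENNReal.toReal_nonneg (M.prodRho_some_le_one A c y t m)

theorem expReward_nonpos_of_not_acc (hc : c ≤ 0) (x : S × Q)
    (hx : ∀ y, Relation.ReflTransGen π.Edge x y → ⟨y, π.choose y⟩ ∉ M.prodAcc A) (n : ℕ) :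
    (M.prodReward (A.rewardMachine c)).expReward (M.prodRho (A.rewardMachine c))
      π.toStrategy n x ≤ 0 := by
  have key := (M.prodReward (A.rewardMachine c)).expReward_le
    (ρ := M.prodRho (A.rewardMachine c)) (Q := fun y a => a = π.choose y) π.toStrategy
    π.toStrategy_ne_zero (C := {y | Relation.ReflTransGen π.Edge x y})
    (h := fun y => 0) (g := 0) ?_ (fun y _ => le_rfl) ?_ n x Relation.ReflTransGen.refl
  · simpa using key
  · rintro y hy a rfl t ht
    exact Relation.ReflTransGen.tail hy ht
  · rintro y hy a rfl
    rw [zero_add]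
    refine Finset.sum_nonpos fun t _ => mul_nonpos_of_nonneg_of_nonpos ENNReal.toReal_nonneg ?_
    rw [add_zero]
    exact M.prodRho_nonpos A hc (hx y hy)

end bounded

/-! ### Runs with finitely many resets -/

/-- A run with infinitely many accepting steps after its last reset satisfies the language: the
labels after the last reset are read by an accepting run of the automaton from its initial state,
and absolute liveness allows for the labels before. -/
theorem mem_prodSatisfies {M : LabelledMDP S Act AP} {A : BuchiAutomaton (Set AP) Q} {c : ℝ}
    (hA : IsAbsoluteLiveness A.language) {z : ℕ → Step (S × Q) (Option (Act × Q))}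
    (h0 : (z 0).state.2 = A.init)
    (hz : ∀ n, (z n).action ∈ (M.prodReward (A.rewardMachine c)).avail (z n).state ∧
      (M.prodReward (A.rewardMachine c)).T (z n).state (z n).action (z (n + 1)).state ≠ 0)
    (heps : ∀ᶠ n in atTop, (z n).action ≠ none) (hacc : ∃ᶠ n in atTop, z n ∈ M.prodAcc A) :
    z ∈ M.prodSatisfies A.language := by
  classical
  have hex : ∃ m, ∀ n ≥ m, (z n).action ≠ none := eventually_atTop.1 heps
  obtain ⟨m, hm, hq⟩ : ∃ m, (∀ n ≥ m, (z n).action ≠ none) ∧ (z m).state.2 = A.init := by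
    refine ⟨Nat.find hex, Nat.find_spec hex, ?_⟩
    rcases hk : Nat.find hex with _ | k
    · exact h0
    · have h1 : (z k).action = none := by
        by_contra hne
        refine Nat.find_min hex (m := k) (by omega) fun n hn => ?_
        rcases hn.eq_or_lt with rfl | hlt
        · exact hne
        · exact Nat.find_spec hex n (by omega)
      have h2 := (hz k).2
      rw [h1] at h2
      have h3 : PMF.pure ((z k).state.1, A.init) (z (k + 1)).state ≠ 0 := h2
      rw [← PMF.mem_support_iff, PMF.support_pure, Set.mem_singleton_iff] at h3
      rw [h3]
  have hinf : {n | (z n).action ≠ none}.Infinite := Nat.frequently_atTop_iff_infinite.1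
    heps.frequently
  refine ⟨hinf, ?_⟩
  have hnth : ∀ j, Nat.nth (fun n => (z n).action ≠ none)
      (Nat.count (fun n => (z n).action ≠ none) m + j) = m + j := by
    intro j
    have h1 : Nat.count (fun n => (z n).action ≠ none) (m + j) =
        Nat.count (fun n => (z n).action ≠ none) m + j := by
      rw [Nat.count_add]
      congr 1
      rw [Nat.count_iff_forall]
      exact fun i _ => hm (m + i) (Nat.le_add_right m i)
    rw [← h1]
    exact Nat.nth_count (p := fun n => (z n).action ≠ none) (hm (m + j) (Nat.le_add_right m j))
  refine hA.of_tail (Nat.count (fun n => (z n).action ≠ none) m) ?_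
  simp only [hnth]
  have hsome : ∀ j, ∃ a, (z (m + j)).action = some (a, (z (m + j + 1)).state.2) ∧
      (z (m + j + 1)).state.2 ∈ A.δ (z (m + j)).state.2 (M.label (z (m + j)).state.1) := by
    intro j
    obtain ⟨⟨a, q'⟩, ha⟩ := Option.ne_none_iff_exists'.1 (hm (m + j) (Nat.le_add_right m j))
    obtain ⟨h1, h2⟩ := hz (m + j)
    rw [ha] at h1 h2
    have h3 : (M.T (z (m + j)).state.1 a).map (fun s' => (s', q')) (z (m + j + 1)).state ≠ 0 := h2
    rw [← PMF.mem_support_iff, PMF.support_map] at h3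
    obtain ⟨s', -, hs'⟩ := h3
    have h4 : (z (m + j + 1)).state.2 = q' := by rw [← hs']
    refine ⟨a, by rw [ha, h4], ?_⟩
    rw [h4]
    exact h1.2
  refine ⟨fun j => (z (m + j)).state.2, hq, fun j => (hsome j).choose_spec.2, ?_⟩
  rw [frequently_atTop] at hacc ⊢
  intro j
  obtain ⟨n, hn, hacc⟩ := hacc (m + j)
  refine ⟨n - m, by omega, ?_⟩
  obtain ⟨a, ha, -⟩ := hsome (n - m)
  have hnm : m + (n - m) = n := by omega
  have hnm' : m + (n - m + 1) = n + 1 := by omega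
  rw [hnm] at ha
  simp only [hnm, hnm']
  simp only [prodAcc, Set.mem_ofPred_eq, ha] at hacc
  exact hacc

/-! ### Optimal positional strategies -/

/-- Once the automaton can be satisfied with positive probability, an optimal positional strategy
satisfies it almost surely: every state that it reaches leads to a region without resets in which
accepting steps recur, as otherwise its total reward from some reachable state is bounded. -/
theorem runMeasure_prodSatisfies_eq_one [Fintype S] [Fintype Act] [Fintype Q]
    {M : LabelledMDP S Act AP} {A : BuchiAutomaton (Set AP) Q} {c p : ℝ} (hM : M.IsCommunicating)
    (hA : IsAbsoluteLiveness A.language) (hp : 0 < p) (hp1 : p ≤ 1)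
    (hpM : ∀ x β y, (M.prodReward (A.rewardMachine c)).T x β y ≠ 0 →
      p ≤ ((M.prodReward (A.rewardMachine c)).T x β y).toReal)
    (hc : c ≤ -stepBound p (Fintype.card (S × Q)))
    (π : (M.prodReward (A.rewardMachine c)).Positional) (s : S)
    (hopt : (M.prodReward (A.rewardMachine c)).IsAvgOptimalFrom
      (M.prodRho (A.rewardMachine c)) π.toStrategy (s, A.init))
    (hpos : M.optSynSat A s ≠ 0) :
    (M.prodReward (A.rewardMachine c)).runMeasure π.toStrategy (s, A.init)
      (M.prodSatisfies A.language) = 1 := by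
  obtain ⟨τ, g, K, hg, hτ⟩ := M.exists_linear_reward A c hM hA s hpos
  have hbad : ∀ x, Relation.ReflTransGen π.Edge (s, A.init) x → ¬ ∃ K, ∀ n,
      (M.prodReward (A.rewardMachine c)).expReward (M.prodRho (A.rewardMachine c))
        π.toStrategy n x ≤ K := by
    rintro x hx ⟨K', hK'⟩
    exact π.not_isAvgOptimalFrom τ _ hg (fun n => hτ n x) hK' hx hopt
  have hc0 : c ≤ 0 := hc.trans (neg_nonpos.2 (stepBound_nonneg hp _))
  let G : Set (S × Q) := {y | (∀ y', Relation.ReflTransGen π.Edge y y' → π.choose y' ≠ none) ∧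
    ⟨y, π.choose y⟩ ∈ M.prodAcc A}
  have hG : ∀ x ∈ {x | Relation.ReflTransGen π.Edge (s, A.init) x},
      ∃ y ∈ G, Relation.ReflTransGen π.Edge x y := by
    intro x hx
    obtain ⟨y, hxy, hy⟩ : ∃ y, Relation.ReflTransGen π.Edge x y ∧
        ∀ y', Relation.ReflTransGen π.Edge y y' → π.choose y' ≠ none := by
      by_contra hcon
      push Not at hcon
      refine hbad x hx (exists_expReward_le_of_reset π hp hp1 hpM hc x fun y hy => ?_)
      obtain ⟨y', h1, h2⟩ := hcon y hy
      exact ⟨y', h2, h1⟩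
    obtain ⟨y', hyy', hy'⟩ : ∃ y', Relation.ReflTransGen π.Edge y y' ∧
        ⟨y', π.choose y'⟩ ∈ M.prodAcc A := by
      by_contra hcon
      push Not at hcon
      exact hbad y (Relation.ReflTransGen.trans hx hxy)
        ⟨0, expReward_nonpos_of_not_acc π hc0 y hcon⟩
    exact ⟨y', ⟨fun y'' h => hy y'' (hyy'.trans h), hy'⟩, hxy.trans hyy'⟩
  have hfreq := π.ae_frequently_mem (fun x hx y hy => Relation.ReflTransGen.tail hx hy) hG
    (s, A.init) Relation.ReflTransGen.refl
  have hsteps := MDP.ae_steps (M.prodReward (A.rewardMachine c)) (Q := fun y a => a = π.choose y)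
    π.toStrategy π.toStrategy_ne_zero (s, A.init)
  have hzero := MDP.ae_state_zero (M.prodReward (A.rewardMachine c)) π.toStrategy (s, A.init)
  have hae : ∀ᵐ z ∂(M.prodReward (A.rewardMachine c)).runMeasure π.toStrategy (s, A.init),
      z ∈ M.prodSatisfies A.language := by
    filter_upwards [hfreq, hsteps, hzero] with z h1 h2 h3
    refine mem_prodSatisfies (c := c) hA (by rw [h3]) (fun n => ⟨?_, (h2 n).2⟩) ?_ ?_
    · rw [(h2 n).1]
      exact π.mem_avail _
    · obtain ⟨n₀, hn₀⟩ := h1.exists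
      have hpath : ∀ k, Relation.ReflTransGen π.Edge (z n₀).state (z (n₀ + k)).state := by
        intro k
        induction k with
        | zero => exact .refl
        | succ k ih =>
          refine ih.tail ?_
          have h4 := h2 (n₀ + k)
          rw [h4.1] at h4
          exact h4.2
      refine eventually_atTop.2 ⟨n₀, fun n hn => ?_⟩
      rw [(h2 n).1]
      have h5 := hpath (n - n₀)
      rw [Nat.add_sub_cancel' hn] at h5
      exact hn₀.1 _ h5
    · refine h1.mono fun n hn => ?_
      have h4 : z n = ⟨(z n).state, π.choose (z n).state⟩ := by rw [← (h2 n).1]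
      rw [h4]
      exact hn.2
  refine le_antisymm prob_le_one ?_
  rw [← measure_univ (μ := (M.prodReward (A.rewardMachine c)).runMeasure π.toStrategy (s, A.init))]
  exact measure_mono_ae (hae.mono fun z hz _ => hz)

end LabelledMDP

theorem mainTheorem2 {S : Type u} {Act : Type v} {AP : Type w} {Q : Type x}
    [Finite S] [Finite Act] [Finite AP] [Finite Q]
    (M : LabelledMDP S Act AP) (A : BuchiAutomaton (Set AP) Q)
    (hM : M.IsCommunicating)
    (hGFM : BuchiAutomaton.IsGoodForMDPs.{u, v} A)
    (hA : IsAbsoluteLiveness A.language) :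
    ∃ cstar : ℝ, cstar < 0 ∧ ∀ c : ℝ, c < cstar →
      ∀ (π : (M.prodReward (A.rewardMachine c)).Positional) (s : S),
        (M.prodReward (A.rewardMachine c)).IsAvgOptimalFrom
            (M.prodRho (A.rewardMachine c)) π.toStrategy (s, A.init) →
          (M.prodReward (A.rewardMachine c)).runMeasure π.toStrategy (s, A.init)
              (M.prodSatisfies A.language) = M.optSemSat A s ∧
            M.semSat A (LabelledMDP.induced π) s = M.optSemSat A s := by
  cases nonempty_fintype S
  cases nonempty_fintype Act
  cases nonempty_fintype Q
  -- The transition probabilities of the product do not depend on the reward `c` of a reset.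
  obtain ⟨p, hp, hp1, hpM⟩ := (M.prodReward (A.rewardMachine 0)).exists_minProb
  have hB := stepBound_nonneg hp (Fintype.card (S × Q))
  refine ⟨-(stepBound p (Fintype.card (S × Q)) + 1), by linarith, fun c hc π s hopt => ?_⟩
  have h1 : (M.prodReward (A.rewardMachine c)).runMeasure π.toStrategy (s, A.init)
      (M.prodSatisfies A.language) ≤ M.semSat A (LabelledMDP.induced π) s :=
    LabelledMDP.runMeasure_prodSatisfies_le (fun _ => rfl) π A.language s
  have h2 : M.semSat A (LabelledMDP.induced π) s ≤ M.optSemSat A s :=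
    le_iSup (fun σ : M.Strategy => M.semSat A σ s) (LabelledMDP.induced π)
  have h3 : M.optSemSat A s ≤ (M.prodReward (A.rewardMachine c)).runMeasure π.toStrategy
      (s, A.init) (M.prodSatisfies A.language) := by
    by_cases hpos : M.optSynSat A s = 0
    · rw [← hGFM S Act M s, hpos]
      exact zero_le
    · have hc' : c ≤ -stepBound p (Fintype.card (S × Q)) := by linarith
      have hT : (M.prodReward (A.rewardMachine c)).T = (M.prodReward (A.rewardMachine 0)).T := by
        funext x β
        cases β <;> rfl
      rw [LabelledMDP.runMeasure_prodSatisfies_eq_one hM hA hp hp1 (by rwa [hT]) hc' π s hopt hpos]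
      exact iSup_le fun σ => prob_le_one
  exact ⟨le_antisymm (h1.trans h2) h3, le_antisymm h2 (h3.trans h1)⟩
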